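/- Let $d\ge 1$ and $0<\lambda_1\le\cdots\le\lambda_d$, and let $M=\mathbb R\times\mathbb R^d$, with coordinates $(y,x)=(y,x_1,\dots,x_d)$, carry the Riemannian metric $g=dy^2+\sum_{i=1}^d e^{-2\lambda_i y}\,dx_i^2$. Put $$V=\Bigl\{(y,x)\in M:\ \max_{1\le i\le d}e^{-\lambda_i y/2}|x_i|\le 1\Bigr\},\qquad \mathcal H=\partial\bigl(V\cap\{y\le 0\}\bigr).$$ The set $\mathcal H$ is the union of the $2d+1$ smooth faces $\mathcal H\cap\{y=0\}$ and $\mathcal H\cap\{e^{-\lambda_i y/2}x_i=\pm1\}$, $1\le i\le d$, which meet only along their boundaries. Let $\operatorname{Vol}_{\mathcal H}$ be the sum of the $d$-dimensional Riemannian volumes induced by $g$ on the faces, let $\operatorname{dist}_{\mathcal H}(p,q)$ be the infimum of the $g$-lengths of the Lipschitz curves in $\mathcal H$ from $p$ to $q$, let $B_{\mathcal H}(p,r)=\{q\in\mathcal H:\operatorname{dist}_{\mathcal H}(p,q)<r\}$, and let $\omega_d$ be the volume of the unit ball of the Euclidean space $\mathbb R^d$. (a) For all $\epsilon>0$ and $r>0$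 there exists $y(\epsilon,r)<0$ such that for every $p=(y_p,x_p)\in\mathcal H$ with $y_p\le y(\epsilon,r)$ the volume $\operatorname{Vol}_{\mathcal H}(B_{\mathcal H}(p,r))$ is finite and $$\left|\frac{\operatorname{Vol}_{\mathcal H}\bigl(B_{\mathcal H}(p,r)\bigr)}{\omega_d r^d}-1\right|\le\epsilon.$$ (b) $(\mathcal H,\operatorname{dist}_{\mathcal H},\operatorname{Vol}_{\mathcal H})$ has controlled volume: for each $r>0$ there exist real numbers $0<v(r)<V(r)$ such that $v(r)\le\operatorname{Vol}_{\mathcal H}(B_{\mathcal H}(p,r))\le V(r)$ for all $p\in\mathcal H$. -/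

import Mathlib

open MeasureTheory Set
open scoped ENNReal NNReal

noncomputable section

namespace Heintze

/-- The underlying manifold `ℝ × ℝ^d` of the Heintze group, in its global coordinates `(y, x)`.
Tangent vectors are written in the same coordinates. -/
abbrev Point (d : ℕ) : Type := ℝ × (Fin d → ℝ)

/-- The Riemannian metric `g = dy² + ∑ᵢ e^{-2 λᵢ y} dxᵢ²` at the point `p`. -/
def metric {d : ℕ} (lam : Fin d → ℝ) (p v w : Point d) : ℝ :=
  v.1 * w.1 + ∑ i, Real.exp (-2 * lam i * p.1) * (v.2 i * w.2 i)

/-- The Riemannian norm of the tangent vector `v` at `p`. -/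
def tangentNorm {d : ℕ} (lam : Fin d → ℝ) (p v : Point d) : ℝ :=
  Real.sqrt (metric lam p v v)

/-- The Riemannian length of a Lipschitz curve `γ : [0, 1] → ℝ × ℝ^d`
(differentiable almost everywhere by Rademacher's theorem). -/
def curveLength {d : ℕ} (lam : Fin d → ℝ) (γ : ℝ → Point d) : ℝ≥0∞ :=
  ∫⁻ t in Icc (0 : ℝ) 1, ENNReal.ofReal (tangentNorm lam (γ t) (deriv γ t))

/-- `γ` restricts to a Lipschitz curve `[0, 1] → X` from `p` to `q`. Being Lipschitz on the compact
interval does not depend on the choice between the coordinate norm and the Riemannian distance. -/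
structure IsCurveIn {d : ℕ} (X : Set (Point d)) (p q : Point d) (γ : ℝ → Point d) : Prop where
  lipschitz : ∃ K : ℝ≥0, LipschitzOnWith K γ (Icc 0 1)
  mem : ∀ t ∈ Icc (0 : ℝ) 1, γ t ∈ X
  source : γ 0 = p
  target : γ 1 = q

/-- The induced (intrinsic, length) distance on `X`: the infimum of the Riemannian lengths of the
curves in `X` from `p` to `q`, and `∞` when there is none. -/
def inducedDist {d : ℕ} (lam : Fin d → ℝ) (X : Set (Point d)) (p q : Point d) : ℝ≥0∞ :=
  ⨅ (γ : ℝ → Point d) (_ : IsCurveIn X p q γ), curveLength lam γ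

/-- The open ball of radius `r` around `p` for the induced distance on `X`. -/
def intrinsicBall {d : ℕ} (lam : Fin d → ℝ) (X : Set (Point d)) (p : Point d) (r : ℝ) :
    Set (Point d) :=
  {q | q ∈ X ∧ inducedDist lam X p q < ENNReal.ofReal r}

/-- The set `V = {(y, x) : maxᵢ e^{-λᵢ y / 2} |xᵢ| ≤ 1}`. -/
def V {d : ℕ} (lam : Fin d → ℝ) : Set (Point d) :=
  {p | ∀ i, Real.exp (-(lam i * p.1 / 2)) * |p.2 i| ≤ 1}

/-- The approximate horosphere: the boundary of `V ∩ {y ≤ 0}`. -/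
def approxHorosphere {d : ℕ} (lam : Fin d → ℝ) : Set (Point d) :=
  frontier (V lam ∩ {p | p.1 ≤ 0})

/-- The Riemannian volume density `√det (φ^* g)` of a parametrization `φ` of a `d`-dimensional
submanifold: the square root of the Gram determinant of the vectors `∂φ/∂u_a`. -/
def volumeDensity {d : ℕ} (lam : Fin d → ℝ) (φ : (Fin d → ℝ) → Point d) (u : Fin d → ℝ) : ℝ :=
  Real.sqrt (Matrix.det (Matrix.of fun a b : Fin d =>
    metric lam (φ u) (fderiv ℝ φ u (Pi.single a 1)) (fderiv ℝ φ u (Pi.single b 1))))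

/-- The Riemannian volume, as a measure on the ambient space, of the `d`-dimensional piece `φ(D)`
parametrized injectively by `φ` on `D`. -/
def pieceVolume {d : ℕ} (lam : Fin d → ℝ) (φ : (Fin d → ℝ) → Point d) (D : Set (Fin d → ℝ)) :
    Measure (Point d) :=
  Measure.map φ
    ((volume.restrict D).withDensity fun u => ENNReal.ofReal (volumeDensity lam φ u))

/-- Parametrization `x ↦ (0, x)` of the horizontal face of the approximate horosphere. -/
def baseParam (d : ℕ) (x : Fin d → ℝ) : Point d := (0, x)

/-- Domain of `baseParam`: the face is `{y = 0, maxᵢ |xᵢ| ≤ 1}`. -/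
def baseDomain (d : ℕ) : Set (Fin d → ℝ) := {x | ∀ i, |x i| ≤ 1}

/-- Parametrization of the lateral face `{e^{-λᵢ y / 2} xᵢ = s}`, `s = ±1`, by `y` and the `x_j`
with `j ≠ i`. The coordinate `u i` plays the role of `y`, the others are the `x_j`. -/
def sideParam {d : ℕ} (lam : Fin d → ℝ) (i : Fin d) (s : ℝ) (u : Fin d → ℝ) : Point d :=
  (u i, Function.update u i (s * Real.exp (lam i * u i / 2)))

/-- Domain of `sideParam`: `y ≤ 0` and `e^{-λ_j y / 2} |x_j| ≤ 1` for `j ≠ i`. -/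
def sideDomain {d : ℕ} (lam : Fin d → ℝ) (i : Fin d) : Set (Fin d → ℝ) :=
  {u | u i ≤ 0 ∧ ∀ j, j ≠ i → Real.exp (-(lam j * u i / 2)) * |u j| ≤ 1}

/-- The Riemannian volume of the approximate horosphere. It is the union of its `2 d + 1` smooth
faces, which meet only along their boundaries (null sets), so the volumes of the faces add up. -/
def horosphereVolume {d : ℕ} (lam : Fin d → ℝ) : Measure (Point d) :=
  pieceVolume lam (baseParam d) (baseDomain d) +
    ∑ i, (pieceVolume lam (sideParam lam i 1) (sideDomain lam i) +
      pieceVolume lam (sideParam lam i (-1)) (sideDomain lam i))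

/-- `X`, with distance `dst` and measure `μ`, has controlled volume: the measure of the balls of
each radius `r > 0` is bounded above and away from `0`, uniformly in the center. -/
def HasControlledVolume {X : Type*} [MeasurableSpace X] (dst : X → X → ℝ≥0∞) (μ : Measure X) :
    Prop :=
  ∀ r : ℝ, 0 < r → ∃ v W : ℝ, 0 < v ∧ v < W ∧ ∀ p : X,
    ENNReal.ofReal v ≤ μ {q | dst p q < ENNReal.ofReal r} ∧
      μ {q | dst p q < ENNReal.ofReal r} ≤ ENNReal.ofReal W

/-- The volume of the unit ball of the Euclidean space `ℝ^d`. -/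
def unitBallVolume (d : ℕ) : ℝ :=
  (volume (Metric.ball (0 : EuclideanSpace ℝ (Fin d)) 1)).toReal

end Heintze

end

namespace Heintze

variable {d : ℕ} {lam : Fin d → ℝ}

/-- The part of the approximate horosphere that lies on the boundary of `V`. -/
def lowerSheet (lam : Fin d → ℝ) : Set (Point d) :=
  {p | p.1 ≤ 0 ∧ (∀ i, |p.2 i| ≤ Real.exp (lam i * p.1 / 2)) ∧
    ∃ i, |p.2 i| = Real.exp (lam i * p.1 / 2)}

theorem exp_neg_mul_le_one_iff (a b : ℝ) : Real.exp (-a) * b ≤ 1 ↔ b ≤ Real.exp a := by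
  rw [Real.exp_neg, inv_mul_le_iff₀ (Real.exp_pos a), mul_one]

theorem isClosed_body (lam : Fin d → ℝ) : IsClosed (V lam ∩ {p | p.1 ≤ 0}) := by
  have hV : V lam = ⋂ i, {p : Point d | Real.exp (-(lam i * p.1 / 2)) * |p.2 i| ≤ 1} := by
    ext p; simp [V]
  rw [hV]
  refine (isClosed_iInter fun i => isClosed_le (by fun_prop) continuous_const).inter ?_
  exact isClosed_le continuous_fst continuous_const

theorem notMem_interior_of_path {X : Type*} [TopologicalSpace X] {s : Set X} {p : X} (f : ℝ → X)
    (hf : ContinuousAt f 0) (h0 : f 0 = p) (h : ∀ t, 0 < t → f t ∉ s) : p ∉ interior s := by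
  intro hp
  have h1 : ∀ᶠ t in nhds (0 : ℝ), f t ∈ s :=
    hf.eventually_mem (by rw [h0]; exact mem_interior_iff_mem_nhds.mp hp)
  have h2 : ∀ᶠ t in nhdsWithin (0 : ℝ) (Ioi 0), f t ∈ s := h1.filter_mono nhdsWithin_le_nhds
  obtain ⟨t, ht, ht'⟩ := (h2.and self_mem_nhdsWithin).exists
  exact h t ht' ht

theorem mem_approxHorosphere_iff {p : Point d} :
    p ∈ approxHorosphere lam ↔ p.1 ≤ 0 ∧ (∀ i, |p.2 i| ≤ Real.exp (lam i * p.1 / 2)) ∧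
      (p.1 = 0 ∨ ∃ i, |p.2 i| = Real.exp (lam i * p.1 / 2)) := by
  have hmem : ∀ q : Point d, q ∈ V lam ∩ {p | p.1 ≤ 0} ↔
      q.1 ≤ 0 ∧ ∀ i, |q.2 i| ≤ Real.exp (lam i * q.1 / 2) := by
    intro q
    simp only [V, mem_inter_iff, mem_ofPred_eq, exp_neg_mul_le_one_iff, and_comm]
  rw [approxHorosphere, (isClosed_body lam).frontier_eq, Set.mem_sdiff, hmem, and_assoc]
  refine and_congr_right fun hy => and_congr_right fun hx => ⟨fun h => ?_, ?_⟩
  · by_contra! hcon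
    apply h
    have hopen : IsOpen {q : Point d | q.1 < 0 ∧ ∀ i, |q.2 i| < Real.exp (lam i * q.1 / 2)} := by
      have : {q : Point d | q.1 < 0 ∧ ∀ i, |q.2 i| < Real.exp (lam i * q.1 / 2)} =
          {q | q.1 < 0} ∩ ⋂ i, {q : Point d | |q.2 i| < Real.exp (lam i * q.1 / 2)} := by
        ext q; simp
      rw [this]
      exact (isOpen_lt continuous_fst continuous_const).inter
        (isOpen_iInter_of_finite fun i => isOpen_lt (by fun_prop) (by fun_prop))
    refine mem_interior.mpr ⟨_, fun q hq => (hmem q).mpr ⟨hq.1.le, fun i => (hq.2 i).le⟩, hopen,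
      lt_of_le_of_ne hy hcon.1, fun i => lt_of_le_of_ne (hx i) (hcon.2 i)⟩
  · rintro (h0 | ⟨i, hi⟩)
    · refine notMem_interior_of_path (fun t => (p.1 + t, p.2)) (by fun_prop) (by simp) ?_
      intro t ht hmt
      have := ((hmem _).mp hmt).1
      simp only [h0] at this
      linarith
    · refine notMem_interior_of_path (fun t => (p.1, (1 + t) • p.2)) (by fun_prop) (by simp) ?_
      intro t ht hmt
      have := ((hmem _).mp hmt).2 i
      simp only [Pi.smul_apply, smul_eq_mul, abs_mul, abs_of_pos (by linarith : 0 < 1 + t),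
        hi] at this
      nlinarith [Real.exp_pos (lam i * p.1 / 2)]

theorem lowerSheet_subset : lowerSheet lam ⊆ approxHorosphere lam := fun _ hp =>
  mem_approxHorosphere_iff.mpr ⟨hp.1, hp.2.1, Or.inr hp.2.2⟩

theorem mem_lowerSheet_of_neg {p : Point d} (hp : p ∈ approxHorosphere lam) (h : p.1 < 0) :
    p ∈ lowerSheet lam := by
  obtain ⟨h1, h2, h3⟩ := mem_approxHorosphere_iff.mp hp
  exact ⟨h1, h2, h3.resolve_left h.ne⟩

theorem abs_le_one_of_mem_lowerSheet (hpos : ∀ i, 0 < lam i) {p : Point d}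
    (hp : p ∈ lowerSheet lam) (i : Fin d) : |p.2 i| ≤ 1 :=
  (hp.2.1 i).trans (Real.exp_le_one_iff.mpr (by nlinarith [hpos i, hp.1]))

theorem isClosed_lowerSheet (lam : Fin d → ℝ) : IsClosed (lowerSheet lam) := by
  have : lowerSheet lam = {p | p.1 ≤ 0} ∩
      ((⋂ i, {p : Point d | |p.2 i| ≤ Real.exp (lam i * p.1 / 2)}) ∩
        ⋃ i, {p : Point d | |p.2 i| = Real.exp (lam i * p.1 / 2)}) := by
    ext p; simp [lowerSheet]
  rw [this]
  exact (isClosed_le continuous_fst continuous_const).inter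
    ((isClosed_iInter fun i => isClosed_le (by fun_prop) (by fun_prop)).inter
      (isClosed_iUnion_of_finite fun i => isClosed_eq (by fun_prop) (by fun_prop)))

/-- The vector of `EuclideanSpace ℝ (Fin d)` with coordinates `e^{-λᵢ y} xᵢ`. The Euclidean norm of
`scaled lam y x` is the Riemannian norm of the horizontal vector `x` at height `y`. -/
noncomputable def scaled (lam : Fin d → ℝ) (y : ℝ) : (Fin d → ℝ) →ₗ[ℝ] EuclideanSpace ℝ (Fin d) where
  toFun x := WithLp.toLp 2 fun i => Real.exp (-(lam i * y)) * x i
  map_add' x x' := by ext i; simp [mul_add]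
  map_smul' t x := by ext i; simp [mul_left_comm]

@[simp]
theorem scaled_apply (y : ℝ) (x : Fin d → ℝ) (i : Fin d) :
    scaled lam y x i = Real.exp (-(lam i * y)) * x i := rfl

theorem norm_scaled_sq (y : ℝ) (x : Fin d → ℝ) :
    ‖scaled lam y x‖ ^ 2 = ∑ i, Real.exp (-2 * lam i * y) * (x i * x i) := by
  rw [EuclideanSpace.norm_sq_eq]
  refine Finset.sum_congr rfl fun i _ => ?_
  simp only [scaled_apply, Real.norm_eq_abs, sq_abs, mul_pow]
  rw [← Real.exp_nat_mul]
  push_cast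
  ring_nf

theorem exp_mul_abs_le_norm_scaled (y : ℝ) (x : Fin d → ℝ) (i : Fin d) :
    Real.exp (-(lam i * y)) * |x i| ≤ ‖scaled lam y x‖ := by
  have := PiLp.norm_apply_le (scaled lam y x) i
  simpa [abs_mul] using this

/-- The height function of the lower sheet, truncated from below at `c`. -/
noncomputable def height [NeZero d] (lam : Fin d → ℝ) (c : ℝ) (x : Fin d → ℝ) : ℝ :=
  Finset.univ.sup' Finset.univ_nonempty
    fun i => 2 / lam i * Real.log (max |x i| (Real.exp (lam i * c / 2)))

theorem exp_max_eq (hpos : ∀ i, 0 < lam i) (i : Fin d) (a b : ℝ) :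
    max (Real.exp (lam i * a / 2)) (Real.exp (lam i * b / 2)) =
      Real.exp (lam i * max a b / 2) := by
  have hm : Monotone fun t => Real.exp (lam i * t / 2) := fun a b h =>
    Real.exp_le_exp.mpr (by nlinarith [hpos i])
  exact hm.map_max.symm

section height

variable [NeZero d]

theorem le_height (c : ℝ) (x : Fin d → ℝ) (i : Fin d) :
    2 / lam i * Real.log (max |x i| (Real.exp (lam i * c / 2))) ≤ height lam c x :=
  Finset.le_sup' (fun i => 2 / lam i * Real.log (max |x i| (Real.exp (lam i * c / 2))))
    (Finset.mem_univ i)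

theorem exists_height_eq (lam : Fin d → ℝ) (c : ℝ) (x : Fin d → ℝ) :
    ∃ i, height lam c x = 2 / lam i * Real.log (max |x i| (Real.exp (lam i * c / 2))) := by
  obtain ⟨i, -, hi⟩ := Finset.exists_mem_eq_sup' (Finset.univ_nonempty (α := Fin d))
    (fun i => 2 / lam i * Real.log (max |x i| (Real.exp (lam i * c / 2))))
  exact ⟨i, hi⟩

theorem height_eq_of_mem (hpos : ∀ i, 0 < lam i) {p : Point d} (hp : p ∈ lowerSheet lam)
    (c : ℝ) : height lam c p.2 = max p.1 c := by
  have hval : ∀ i, 2 / lam i * Real.log (Real.exp (lam i * max p.1 c / 2)) = max p.1 c := by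
    intro i
    have := (hpos i).ne'
    rw [Real.log_exp]; field_simp
  apply le_antisymm
  · obtain ⟨i, hi⟩ := exists_height_eq lam c p.2
    rw [hi, ← hval i]
    have := hpos i
    gcongr
    rw [← exp_max_eq hpos]
    exact max_le_max_right _ (hp.2.1 i)
  · obtain ⟨i, hi⟩ := hp.2.2
    refine le_trans (le_of_eq ?_) (le_height c p.2 i)
    rw [hi, exp_max_eq hpos, hval]

theorem height_nonpos (hpos : ∀ i, 0 < lam i) {c : ℝ} (hc : c ≤ 0) {x : Fin d → ℝ}
    (hx : ∀ i, |x i| ≤ 1) : height lam c x ≤ 0 := by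
  obtain ⟨i, hi⟩ := exists_height_eq lam c x
  have hpi := hpos i
  rw [hi]
  refine mul_nonpos_of_nonneg_of_nonpos (by positivity) (Real.log_nonpos (by positivity) ?_)
  exact max_le (hx i) (Real.exp_le_one_iff.mpr (by nlinarith))

theorem mem_lowerSheet_of_height (hpos : ∀ i, 0 < lam i) {c : ℝ} {x : Fin d → ℝ}
    (h0 : height lam c x ≤ 0) (h : c < height lam c x) :
    (height lam c x, x) ∈ lowerSheet lam := by
  have hle : ∀ i, max |x i| (Real.exp (lam i * c / 2)) ≤ Real.exp (lam i * height lam c x / 2) := by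
    intro i
    have h1 := le_height (lam := lam) c x i
    have hpi := hpos i
    rw [← Real.log_le_iff_le_exp (by positivity)]
    rw [div_mul_eq_mul_div, div_le_iff₀ hpi] at h1
    linarith
  refine ⟨h0, fun i => (le_max_left _ _).trans (hle i), ?_⟩
  · obtain ⟨i, hi⟩ := exists_height_eq lam c x
    have hpi := hpos i
    refine ⟨i, le_antisymm ((le_max_left _ _).trans (hle i)) ?_⟩
    rcases max_choice |x i| (Real.exp (lam i * c / 2)) with hm | hm
    · have hx0 : 0 < |x i| := by
        rw [← hm]; positivity
      rw [hm] at hi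
      show Real.exp (lam i * height lam c x / 2) ≤ |x i|
      rw [hi]
      apply le_of_eq
      rw [show lam i * (2 / lam i * Real.log |x i|) / 2 = Real.log |x i| by field_simp,
        Real.exp_log hx0]
    · rw [hm, Real.log_exp] at hi
      exfalso
      rw [show 2 / lam i * (lam i * c / 2) = c by field_simp] at hi
      linarith

theorem abs_log_sub_log_le {a b m : ℝ} (hm : 0 < m) (ha : m ≤ a) (hb : m ≤ b) :
    |Real.log a - Real.log b| ≤ |a - b| / m := by
  wlog h : b ≤ a generalizing a b
  · rw [abs_sub_comm, abs_sub_comm a b]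
    exact this hb ha (le_of_not_ge h)
  have hb0 : 0 < b := hm.trans_le hb
  have ha0 : 0 < a := hm.trans_le ha
  rw [abs_of_nonneg (sub_nonneg.mpr (Real.log_le_log hb0 h)), abs_of_nonneg (sub_nonneg.mpr h),
    ← Real.log_div ha0.ne' hb0.ne']
  calc Real.log (a / b) ≤ a / b - 1 := Real.log_le_sub_one_of_pos (by positivity)
    _ = (a - b) / b := by field_simp
    _ ≤ (a - b) / m := by gcongr

theorem height_sub_le (hpos : ∀ i, 0 < lam i) {y κ : ℝ}
    (hκ : ∀ i, 2 / lam i * Real.exp (lam i / 2) * Real.exp (lam i * y / 2) ≤ κ)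
    (x x' : Fin d → ℝ) :
    height lam (y - 1) x - height lam (y - 1) x' ≤ κ * ‖scaled lam y (x - x')‖ := by
  obtain ⟨i, hi⟩ := exists_height_eq lam (y - 1) x
  have hpi := hpos i
  have h1 := le_height (lam := lam) (y - 1) x' i
  set m := Real.exp (lam i * (y - 1) / 2) with hm
  have hm0 : 0 < m := Real.exp_pos _
  have h2 : |Real.log (max |x i| m) - Real.log (max |x' i| m)| ≤ |(x - x') i| / m := by
    refine (abs_log_sub_log_le hm0 (le_max_right _ _) (le_max_right _ _)).trans ?_
    refine div_le_div_of_nonneg_right ?_ hm0.le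
    exact (abs_max_sub_max_le_abs _ _ _).trans (abs_abs_sub_abs_le (x i) (x' i))
  calc height lam (y - 1) x - height lam (y - 1) x'
      ≤ 2 / lam i * (Real.log (max |x i| m) - Real.log (max |x' i| m)) := by
        rw [hi, mul_sub]; linarith
    _ ≤ 2 / lam i * (|(x - x') i| / m) := by
        gcongr; exact (le_abs_self _).trans h2
    _ = 2 / lam i * Real.exp (lam i / 2) * Real.exp (lam i * y / 2) *
          (Real.exp (-(lam i * y)) * |(x - x') i|) := by
        rw [hm, div_eq_mul_inv |_|, ← Real.exp_neg,
          show -(lam i * (y - 1) / 2) = lam i / 2 + lam i * y / 2 + -(lam i * y) by ring,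
          Real.exp_add, Real.exp_add]
        ring
    _ ≤ κ * ‖scaled lam y (x - x')‖ := by
        have hk := hκ i
        have h0 : 0 ≤ κ := le_trans (by positivity) hk
        gcongr
        exact exp_mul_abs_le_norm_scaled y _ i

theorem abs_height_sub_le (hpos : ∀ i, 0 < lam i) {y κ : ℝ}
    (hκ : ∀ i, 2 / lam i * Real.exp (lam i / 2) * Real.exp (lam i * y / 2) ≤ κ)
    (x x' : Fin d → ℝ) :
    |height lam (y - 1) x - height lam (y - 1) x'| ≤ κ * ‖scaled lam y (x - x')‖ := by
  refine abs_sub_le_iff.mpr ⟨height_sub_le hpos hκ x x', ?_⟩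
  have := height_sub_le hpos hκ x' x
  rwa [map_sub, norm_sub_rev, ← map_sub] at this

end height

theorem tangentNorm_eq (p v : Point d) :
    tangentNorm lam p v = Real.sqrt (v.1 ^ 2 + ‖scaled lam p.1 v.2‖ ^ 2) := by
  rw [tangentNorm, metric, norm_scaled_sq, sq]

theorem abs_fst_le_tangentNorm (p v : Point d) : |v.1| ≤ tangentNorm lam p v := by
  rw [tangentNorm_eq]
  exact Real.abs_le_sqrt (by nlinarith [sq_nonneg ‖scaled lam p.1 v.2‖])

theorem norm_scaled_le_tangentNorm (p v : Point d) :
    ‖scaled lam p.1 v.2‖ ≤ tangentNorm lam p v := by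
  rw [tangentNorm_eq]
  exact Real.le_sqrt_of_sq_le (by nlinarith [sq_nonneg v.1])

theorem norm_scaled_le (hpos : ∀ i, 0 < lam i) {Λ : ℝ} (hΛ : ∀ i, lam i ≤ Λ) {y y' δ : ℝ}
    (hδ : 0 ≤ δ) (h : y' ≤ y + δ) (x : Fin d → ℝ) :
    ‖scaled lam y x‖ ≤ Real.exp (Λ * δ) * ‖scaled lam y' x‖ := by
  refine (sq_le_sq₀ (norm_nonneg _) (by positivity)).mp ?_
  rw [mul_pow, norm_scaled_sq, norm_scaled_sq, Finset.mul_sum]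
  refine Finset.sum_le_sum fun i _ => ?_
  rw [← Real.exp_nat_mul, ← mul_assoc (Real.exp _) (Real.exp _), ← Real.exp_add]
  refine mul_le_mul_of_nonneg_right (Real.exp_le_exp.mpr ?_) (mul_self_nonneg _)
  push_cast
  nlinarith [hpos i, mul_le_mul_of_nonneg_left h (hpos i).le,
    mul_le_mul_of_nonneg_right (hΛ i) hδ]

theorem abs_apply_sub_le_curveLength {γ : ℝ → Point d} {K : ℝ≥0}
    (hγ : LipschitzOnWith K γ (Icc 0 1)) (φ : Point d →L[ℝ] ℝ) {c ℓ : ℝ} (hc : 0 ≤ c)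
    (hφ : ∀ t ∈ Icc (0 : ℝ) 1, ∀ v, |φ v| ≤ c * tangentNorm lam (γ t) v)
    (hℓ : curveLength lam γ ≤ ENNReal.ofReal ℓ) (hℓ0 : 0 ≤ ℓ) {t : ℝ} (ht : t ∈ Icc (0 : ℝ) 1) :
    |φ (γ t) - φ (γ 0)| ≤ c * ℓ := by
  have hsub : uIcc 0 t ⊆ Icc (0 : ℝ) 1 := by
    rw [uIcc_of_le ht.1]; exact Icc_subset_Icc_right ht.2
  have hlip : LipschitzOnWith (‖φ‖₊ * K) (fun s => φ (γ s)) (uIcc 0 t) :=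
    φ.lipschitz.comp_lipschitzOnWith (hγ.mono hsub)
  have hint := hlip.absolutelyContinuousOnInterval.integral_deriv_eq_sub
  have hae : ∀ᵐ s ∂(volume.restrict (Ioc 0 t)), ‖deriv (fun s => φ (γ s)) s‖ₑ ≤
      ENNReal.ofReal c * ENNReal.ofReal (tangentNorm lam (γ s) (deriv γ s)) := by
    have h1 : ∀ᵐ s : ℝ, s ≠ 1 := by simp [ae_iff]
    rw [ae_restrict_iff' measurableSet_Ioc]
    filter_upwards [hγ.ae_differentiableWithinAt_of_mem_real, h1] with s hs hs1 hst
    have hs01 : s ∈ Ioo (0 : ℝ) 1 := ⟨hst.1, lt_of_le_of_ne (hst.2.trans ht.2) hs1⟩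
    have hd : DifferentiableAt ℝ γ s :=
      (hs (Ioo_subset_Icc_self hs01)).differentiableAt (Icc_mem_nhds hs01.1 hs01.2)
    have : HasDerivAt (fun s => φ (γ s)) (φ (deriv γ s)) s :=
      φ.hasFDerivAt.comp_hasDerivAt s hd.hasDerivAt
    rw [this.deriv, ← ENNReal.ofReal_mul hc, ← ofReal_norm, Real.norm_eq_abs]
    exact ENNReal.ofReal_le_ofReal (hφ s (Ioo_subset_Icc_self hs01) _)
  have key : ENNReal.ofReal |φ (γ t) - φ (γ 0)| ≤ ENNReal.ofReal (c * ℓ) := by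
    rw [← hint, intervalIntegral.integral_of_le ht.1, ← Real.norm_eq_abs, ofReal_norm]
    calc _ ≤ ∫⁻ s in Ioc 0 t, ‖deriv (fun s => φ (γ s)) s‖ₑ := enorm_integral_le_lintegral_enorm _
      _ ≤ ∫⁻ s in Ioc 0 t,
            ENNReal.ofReal c * ENNReal.ofReal (tangentNorm lam (γ s) (deriv γ s)) :=
          lintegral_mono_ae hae
      _ ≤ ∫⁻ s in Icc 0 1,
            ENNReal.ofReal c * ENNReal.ofReal (tangentNorm lam (γ s) (deriv γ s)) :=
          lintegral_mono_set (Ioc_subset_Icc_self.trans (Icc_subset_Icc_right ht.2))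
      _ = ENNReal.ofReal c * curveLength lam γ := lintegral_const_mul' _ _ ENNReal.ofReal_ne_top
      _ ≤ ENNReal.ofReal (c * ℓ) := by rw [ENNReal.ofReal_mul hc]; gcongr
  exact (ENNReal.ofReal_le_ofReal_iff (by positivity)).mp key

theorem norm_scaled_sub_le_of_curveLength (hpos : ∀ i, 0 < lam i) {Λ : ℝ} (hΛ : ∀ i, lam i ≤ Λ)
    {γ : ℝ → Point d} {K : ℝ≥0} (hγ : LipschitzOnWith K γ (Icc 0 1)) {y δ ℓ : ℝ} (hδ : 0 ≤ δ)
    (hy : ∀ t ∈ Icc (0 : ℝ) 1, (γ t).1 ≤ y + δ)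
    (hℓ : curveLength lam γ ≤ ENNReal.ofReal ℓ) (hℓ0 : 0 ≤ ℓ) {t : ℝ} (ht : t ∈ Icc (0 : ℝ) 1) :
    ‖scaled lam y ((γ t).2 - (γ 0).2)‖ ≤ Real.exp (Λ * δ) * ℓ := by
  set u := scaled lam y ((γ t).2 - (γ 0).2) with hu
  rcases eq_or_ne u 0 with h0 | h0
  · rw [h0, norm_zero]; positivity
  let φ : Point d →L[ℝ] ℝ := LinearMap.toContinuousLinearMap
    ((innerSL ℝ u).toLinearMap ∘ₗ scaled lam y ∘ₗ LinearMap.snd ℝ ℝ (Fin d → ℝ))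
  have hφ : ∀ v, φ v = inner ℝ u (scaled lam y v.2) := fun v => rfl
  have h := abs_apply_sub_le_curveLength hγ φ (c := ‖u‖ * Real.exp (Λ * δ)) (by positivity)
    (fun s hs v => by
      rw [hφ, mul_assoc]
      refine (abs_real_inner_le_norm _ _).trans ?_
      gcongr
      refine (norm_scaled_le hpos hΛ hδ (hy s hs) _).trans ?_
      gcongr
      exact norm_scaled_le_tangentNorm _ _) hℓ hℓ0 ht
  rw [hφ, hφ, ← inner_sub_right, ← map_sub, ← hu, real_inner_self_eq_norm_sq,
    abs_of_nonneg (sq_nonneg _), sq, mul_assoc] at h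
  exact le_of_mul_le_mul_left h (norm_pos_iff.mpr h0)

theorem abs_fst_sub_le_of_curveLength
    {γ : ℝ → Point d} {K : ℝ≥0} (hγ : LipschitzOnWith K γ (Icc 0 1)) {ℓ : ℝ}
    (hℓ : curveLength lam γ ≤ ENNReal.ofReal ℓ) (hℓ0 : 0 ≤ ℓ) {t : ℝ} (ht : t ∈ Icc (0 : ℝ) 1) :
    |(γ t).1 - (γ 0).1| ≤ ℓ := by
  have h := abs_apply_sub_le_curveLength hγ (ContinuousLinearMap.fst ℝ ℝ (Fin d → ℝ))
    zero_le_one (fun s _ v => by simpa using abs_fst_le_tangentNorm (γ s) v) hℓ hℓ0 ht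
  simpa using h

theorem exists_curve_of_inducedDist_lt {X : Set (Point d)} {p q : Point d} {r : ℝ≥0∞}
    (h : inducedDist lam X p q < r) : ∃ γ, IsCurveIn X p q γ ∧ curveLength lam γ < r := by
  simpa [inducedDist, iInf_lt_iff] using h

theorem abs_fst_sub_le_of_mem_ball {X : Set (Point d)} {p q : Point d} {r : ℝ} (hr : 0 < r)
    (hq : q ∈ intrinsicBall lam X p r) : |q.1 - p.1| ≤ r := by
  obtain ⟨γ, hγ, hlen⟩ := exists_curve_of_inducedDist_lt hq.2
  obtain ⟨K, hK⟩ := hγ.lipschitz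
  have := abs_fst_sub_le_of_curveLength hK hlen.le hr.le (right_mem_Icc.mpr zero_le_one)
  rwa [hγ.source, hγ.target] at this

theorem curveLength_le {γ : ℝ → Point d} {C : ℝ}
    (h : ∀ t ∈ Icc (0 : ℝ) 1, tangentNorm lam (γ t) (deriv γ t) ≤ C) :
    curveLength lam γ ≤ ENNReal.ofReal C := by
  calc curveLength lam γ ≤ ∫⁻ _ in Icc (0 : ℝ) 1, ENNReal.ofReal C :=
        setLIntegral_mono measurable_const fun t ht => ENNReal.ofReal_le_ofReal (h t ht)
    _ = ENNReal.ofReal C := by simp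

section lowerSheet

variable [NeZero d]

theorem abs_fst_sub_le_of_mem_lowerSheet (hpos : ∀ i, 0 < lam i) {κ : ℝ} {p q : Point d}
    (hp : p ∈ lowerSheet lam) (hq : q ∈ lowerSheet lam)
    (hκ : ∀ i, 2 / lam i * Real.exp (lam i / 2) * Real.exp (lam i * p.1 / 2) ≤ κ)
    (h1 : κ * ‖scaled lam p.1 (q.2 - p.2)‖ < 1) :
    |q.1 - p.1| ≤ κ * ‖scaled lam p.1 (q.2 - p.2)‖ := by
  have h := abs_height_sub_le hpos hκ q.2 p.2
  rw [height_eq_of_mem hpos hp, height_eq_of_mem hpos hq, max_eq_left (by linarith : p.1 - 1 ≤ p.1)]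
    at h
  rcases max_choice q.1 (p.1 - 1) with hm | hm
  · rwa [hm] at h
  · rw [hm] at h
    have := neg_le_of_abs_le h
    linarith

theorem exists_mem_lowerSheet (hpos : ∀ i, 0 < lam i) {κ : ℝ} {p : Point d}
    (hp : p ∈ lowerSheet lam)
    (hκ : ∀ i, 2 / lam i * Real.exp (lam i / 2) * Real.exp (lam i * p.1 / 2) ≤ κ)
    {x : Fin d → ℝ} (h1 : κ * ‖scaled lam p.1 (x - p.2)‖ < 1)
    (h0 : p.1 + κ * ‖scaled lam p.1 (x - p.2)‖ ≤ 0 ∨ ∀ i, |x i| ≤ 1) :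
    ∃ y, (y, x) ∈ lowerSheet lam := by
  have h := abs_height_sub_le hpos hκ x p.2
  rw [height_eq_of_mem hpos hp, max_eq_left (by linarith : p.1 - 1 ≤ p.1), abs_le] at h
  refine ⟨_, mem_lowerSheet_of_height hpos (h0.elim (fun h0 => by linarith) fun hx => ?_)
    (by linarith : p.1 - 1 < _)⟩
  exact height_nonpos hpos (by linarith [hp.1]) hx

theorem mem_ball_bounds (hpos : ∀ i, 0 < lam i) {Λ : ℝ} (hΛ : ∀ i, lam i ≤ Λ) {κ r : ℝ}
    (hr : 0 < r) {p q : Point d} (hp : p ∈ approxHorosphere lam) (hpr : p.1 + r < 0)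
    (hκ : ∀ i, 2 / lam i * Real.exp (lam i / 2) * Real.exp (lam i * p.1 / 2) ≤ κ)
    (h1 : κ * (Real.exp (Λ * r) * r) < 1)
    (hq : q ∈ intrinsicBall lam (approxHorosphere lam) p r) :
    |q.1 - p.1| ≤ κ * (Real.exp (Λ * r) * r) ∧
      ‖scaled lam p.1 (q.2 - p.2)‖ ≤ Real.exp (Λ * (κ * (Real.exp (Λ * r) * r))) * r := by
  obtain ⟨γ, hγ, hlen⟩ := exists_curve_of_inducedDist_lt hq.2
  obtain ⟨K, hK⟩ := hγ.lipschitz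
  have hκ0 : 0 ≤ κ := by
    have := hpos 0
    exact le_trans (by positivity) (hκ 0)
  have hy : ∀ t ∈ Icc (0 : ℝ) 1, (γ t).1 ≤ p.1 + r := fun t ht => by
    have := le_of_abs_le (abs_fst_sub_le_of_curveLength hK hlen.le hr.le ht)
    rw [hγ.source] at this
    linarith
  have hpL : p ∈ lowerSheet lam := mem_lowerSheet_of_neg hp (by linarith)
  have hy' : ∀ t ∈ Icc (0 : ℝ) 1, |(γ t).1 - p.1| ≤ κ * (Real.exp (Λ * r) * r) := fun t ht => by
    have hn := norm_scaled_sub_le_of_curveLength hpos hΛ hK hr.le hy hlen.le hr.le ht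
    rw [hγ.source] at hn
    have hn' := mul_le_mul_of_nonneg_left hn hκ0
    refine (abs_fst_sub_le_of_mem_lowerSheet hpos hpL ?_ hκ (by linarith)).trans hn'
    exact mem_lowerSheet_of_neg (hγ.mem t ht) ((hy t ht).trans_lt hpr)
  have h01 : (1 : ℝ) ∈ Icc (0 : ℝ) 1 := right_mem_Icc.mpr zero_le_one
  have hn := norm_scaled_sub_le_of_curveLength hpos hΛ hK
    (by positivity : 0 ≤ κ * (Real.exp (Λ * r) * r))
    (fun t ht => by linarith [le_of_abs_le (hy' t ht)] : ∀ t ∈ Icc (0 : ℝ) 1, (γ t).1 ≤ p.1 + _)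
    hlen.le hr.le h01
  have hy1 := hy' 1 h01
  rw [hγ.target] at hy1
  rw [hγ.source, hγ.target] at hn
  exact ⟨hy1, hn⟩

theorem inducedDist_le_of_mem_lowerSheet (hpos : ∀ i, 0 < lam i) {Λ : ℝ} (hΛ : ∀ i, lam i ≤ Λ)
    {κ ρ : ℝ} {p q : Point d} (hp : p ∈ lowerSheet lam) (hq : q ∈ lowerSheet lam)
    (hκ : ∀ i, 2 / lam i * Real.exp (lam i / 2) * Real.exp (lam i * p.1 / 2) ≤ κ)
    (hρ : ‖scaled lam p.1 (q.2 - p.2)‖ ≤ ρ) (h1 : κ * ρ < 1) :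
    inducedDist lam (approxHorosphere lam) p q ≤
      ENNReal.ofReal (Real.sqrt (κ ^ 2 + Real.exp (Λ * (κ * ρ)) ^ 2) *
        ‖scaled lam p.1 (q.2 - p.2)‖) := by
  have hκ0 : 0 ≤ κ := by
    have := hpos 0
    exact le_trans (by positivity) (hκ 0)
  have hρ0 : 0 ≤ ρ := (norm_nonneg _).trans hρ
  set v := q.2 - p.2 with hv
  set N := ‖scaled lam p.1 v‖ with hN
  let x : ℝ → Fin d → ℝ := fun t => p.2 + t • v
  let γ : ℝ → Point d := fun t => (height lam (p.1 - 1) (x t), x t)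
  have hx0 : x 0 = p.2 := by simp [x]
  have hx1 : x 1 = q.2 := by simp [x, hv]
  have hxsub : ∀ t s, x t - x s = (t - s) • v := fun t s => by
    simp only [x]; module
  have hcp : height lam (p.1 - 1) p.2 = p.1 := by
    rw [height_eq_of_mem hpos hp, max_eq_left (by linarith)]
  have hlip : ∀ t s, |height lam (p.1 - 1) (x t) - height lam (p.1 - 1) (x s)| ≤
      κ * N * |t - s| := fun t s => by
    refine (abs_height_sub_le hpos hκ _ _).trans (le_of_eq ?_)
    rw [hxsub, map_smul, norm_smul, Real.norm_eq_abs]; ring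
  have hL1 : LipschitzWith (Real.toNNReal (κ * N)) fun t => height lam (p.1 - 1) (x t) := by
    refine LipschitzWith.of_dist_le_mul fun t s => ?_
    rw [Real.coe_toNNReal _ (by positivity)]
    exact hlip t s
  have hL2 : LipschitzWith ‖v‖₊ x := by
    refine LipschitzWith.of_dist_le_mul fun t s => ?_
    rw [dist_eq_norm, hxsub, norm_smul, coe_nnnorm, mul_comm, dist_eq_norm]
  have hclose : ∀ t ∈ Icc (0 : ℝ) 1, |(γ t).1 - p.1| ≤ κ * ρ := fun t ht => by
    have := hlip t 0
    rw [hx0, hcp, sub_zero, abs_of_nonneg ht.1] at this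
    refine this.trans ?_
    rw [mul_assoc]
    gcongr
    nlinarith [ht.2, norm_nonneg (scaled lam p.1 v)]
  have hqL : height lam (p.1 - 1) q.2 = q.1 := by
    have h := abs_fst_sub_le_of_mem_lowerSheet hpos hp hq hκ
      (lt_of_le_of_lt (mul_le_mul_of_nonneg_left hρ hκ0) h1)
    have h' := neg_le_of_abs_le h
    rw [height_eq_of_mem hpos hq, max_eq_left]
    have := mul_le_mul_of_nonneg_left hρ hκ0
    linarith
  have hcurve : IsCurveIn (approxHorosphere lam) p q γ := by
    refine ⟨⟨_, (hL1.prodMk hL2).lipschitzOnWith⟩, fun t ht => ?_, ?_, ?_⟩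
    · refine lowerSheet_subset (mem_lowerSheet_of_height hpos
        (height_nonpos hpos (by linarith [hp.1]) fun i => ?_) ?_)
      · have hpi := abs_le.mp (abs_le_one_of_mem_lowerSheet hpos hp i)
        have hqi := abs_le.mp (abs_le_one_of_mem_lowerSheet hpos hq i)
        simp only [x, hv, Pi.add_apply, Pi.smul_apply, Pi.sub_apply, smul_eq_mul]
        rw [abs_le]
        constructor <;> nlinarith [ht.1, ht.2]
      · have := neg_le_of_abs_le (hclose t ht)
        simp only [γ] at this
        linarith
    · simp only [γ, hx0, hcp]
    · simp only [γ, hx1, hqL]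
  refine (iInf₂_le γ hcurve).trans (curveLength_le fun t ht => ?_)
  rw [tangentNorm_eq]
  by_cases hd : DifferentiableAt ℝ γ t
  · have hfst : |(deriv γ t).1| ≤ κ * N := by
      have h : HasDerivAt (fun t => height lam (p.1 - 1) (x t)) (deriv γ t).1 t :=
        hd.hasDerivAt.fst
      have h2 := norm_deriv_le_of_lipschitz hL1 (x₀ := t)
      rwa [h.deriv, Real.norm_eq_abs, Real.coe_toNNReal _ (by positivity)] at h2
    have hsnd : (deriv γ t).2 = v := by
      have h : HasDerivAt x (deriv γ t).2 t := hd.hasDerivAt.snd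
      have h2 : HasDerivAt x v t := by
        simpa [x] using ((hasDerivAt_id t).smul_const v).const_add p.2
      exact h.unique h2
    have hs := norm_scaled_le hpos hΛ (by positivity : 0 ≤ κ * ρ)
      (by linarith [neg_le_of_abs_le (hclose t ht)] : p.1 ≤ (γ t).1 + κ * ρ) v
    rw [hsnd]
    refine Real.sqrt_le_iff.mpr ⟨by positivity, ?_⟩
    rw [mul_pow, Real.sq_sqrt (by positivity), add_mul, ← mul_pow, ← mul_pow, ← sq_abs (deriv γ t).1]
    gcongr
  · rw [deriv_zero_of_not_differentiableAt hd]
    simp only [Prod.fst_zero, Prod.snd_zero, map_zero, norm_zero]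
    norm_num
    positivity

end lowerSheet

theorem inducedDist_base_le {x x' : Fin d → ℝ} (hx : ∀ i, |x i| ≤ 1)
    (hx' : ∀ i, |x' i| ≤ 1) :
    inducedDist lam (approxHorosphere lam) (0, x) (0, x') ≤
      ENNReal.ofReal ‖scaled lam 0 (x' - x)‖ := by
  let γ : ℝ → Point d := fun t => (0, x + t • (x' - x))
  have hderiv : ∀ t, HasDerivAt γ (0, x' - x) t := fun t => by
    refine (hasDerivAt_const t 0).prodMk ?_
    simpa using ((hasDerivAt_id t).smul_const (x' - x)).const_add x
  have hL : LipschitzWith ‖((0, x' - x) : Point d)‖₊ γ :=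
    lipschitzWith_of_nnnorm_deriv_le (fun t => (hderiv t).differentiableAt)
      fun t => by rw [(hderiv t).deriv]
  have hcurve : IsCurveIn (approxHorosphere lam) (0, x) (0, x') γ := by
    refine ⟨⟨_, hL.lipschitzOnWith⟩, fun t ht => ?_, by simp [γ], by simp [γ]⟩
    refine mem_approxHorosphere_iff.mpr ⟨le_rfl, fun i => ?_, Or.inl rfl⟩
    have hpi := abs_le.mp (hx i)
    have hqi := abs_le.mp (hx' i)
    simp only [γ, Pi.add_apply, Pi.smul_apply, Pi.sub_apply, smul_eq_mul, mul_zero, zero_div,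
      Real.exp_zero]
    rw [abs_le]
    constructor <;> nlinarith [ht.1, ht.2]
  refine (iInf₂_le γ hcurve).trans (curveLength_le fun t _ => ?_)
  rw [tangentNorm_eq, (hderiv t).deriv]
  simp [γ, Real.sqrt_sq]

/-- The continuous linear map of `Fin d → ℝ` with diagonal matrix `diag w`. -/
noncomputable def diagCLM (w : Fin d → ℝ) : (Fin d → ℝ) →L[ℝ] (Fin d → ℝ) :=
  LinearMap.toContinuousLinearMap (Matrix.toLin' (Matrix.diagonal w))

theorem diagCLM_apply (w v : Fin d → ℝ) (j : Fin d) : diagCLM w v j = w j * v j := by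
  simp [diagCLM, Matrix.mulVec_diagonal]

theorem det_diagCLM (w : Fin d → ℝ) : (diagCLM w).det = ∏ j, w j := by
  simp [diagCLM, ContinuousLinearMap.det]

theorem diagCLM_single (w : Fin d → ℝ) (a : Fin d) :
    diagCLM w (Pi.single a 1) = Pi.single a (w a) := by
  ext j
  rw [diagCLM_apply]
  rcases eq_or_ne j a with rfl | h
  · simp
  · simp [h]

/-- The derivative of the `x`-part of `sideParam lam i s` at a point with `u i = y`. -/
noncomputable def sideDeriv (lam : Fin d → ℝ) (i : Fin d) (s y : ℝ) :
    (Fin d → ℝ) →L[ℝ] (Fin d → ℝ) :=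
  diagCLM (Function.update 1 i (s * (lam i / 2) * Real.exp (lam i * y / 2)))

theorem hasFDerivAt_sideParam_snd (i : Fin d) (s : ℝ) (u : Fin d → ℝ) :
    HasFDerivAt (fun u => (sideParam lam i s u).2) (sideDeriv lam i s (u i)) u := by
  rw [hasFDerivAt_pi']
  intro j
  rcases eq_or_ne j i with rfl | h
  · have h1 : HasFDerivAt (fun u : Fin d → ℝ => u j)
        (ContinuousLinearMap.proj (R := ℝ) (φ := fun _ : Fin d => ℝ) j) u :=
      hasFDerivAt_apply j u
    have h2 := (((h1.const_mul (lam j)).mul_const (1 / 2)).exp).const_mul s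
    simp only [sideParam, Function.update_self]
    convert! h2 using 1
    · ext v; ring_nf
    · ext v
      simp [sideDeriv, diagCLM_apply]
      ring_nf
  · simp only [sideParam, Function.update_of_ne h]
    have : (ContinuousLinearMap.proj j).comp (sideDeriv lam i s (u i)) =
        ContinuousLinearMap.proj (R := ℝ) (φ := fun _ : Fin d => ℝ) j := by
      ext v; simp [sideDeriv, diagCLM_apply, h]
    rw [this]
    exact hasFDerivAt_apply j u

theorem hasFDerivAt_sideParam (i : Fin d) (s : ℝ) (u : Fin d → ℝ) :
    HasFDerivAt (sideParam lam i s)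
      ((ContinuousLinearMap.proj (R := ℝ) (φ := fun _ : Fin d => ℝ) i).prod
        (sideDeriv lam i s (u i))) u :=
  (hasFDerivAt_apply i u).prodMk (hasFDerivAt_sideParam_snd i s u)

theorem abs_det_sideDeriv (hpos : ∀ i, 0 < lam i) (i : Fin d) {s : ℝ} (hs : |s| = 1) (y : ℝ) :
    |(sideDeriv lam i s y).det| = lam i / 2 * Real.exp (lam i * y / 2) := by
  have := hpos i
  rw [sideDeriv, det_diagCLM, Finset.prod_update_of_mem (Finset.mem_univ i)]
  simp [abs_mul, hs, abs_of_pos (half_pos this)]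

/-- The ratio of the Riemannian volume on the `i`-th lateral face at height `y` to the Lebesgue
measure of its projection to the `x`-coordinates. -/
noncomputable def graphDensity (lam : Fin d → ℝ) (i : Fin d) (y : ℝ) : ℝ :=
  Real.sqrt (1 + 4 / lam i ^ 2 * Real.exp (lam i * y)) * ∏ j, Real.exp (-(lam j * y))

theorem volumeDensity_sideParam (hpos : ∀ i, 0 < lam i) (i : Fin d) {s : ℝ} (hs : |s| = 1)
    (u : Fin d → ℝ) :
    volumeDensity lam (sideParam lam i s) u =
      |(sideDeriv lam i s (u i)).det| * graphDensity lam i (u i) := by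
  have hpi := hpos i
  set y := u i with hy
  set c := s * (lam i / 2) * Real.exp (lam i * y / 2) with hc
  have hs2 : s ^ 2 = 1 := by rw [← sq_abs, hs, one_pow]
  have hG : (Matrix.of fun a b : Fin d => metric lam (sideParam lam i s u)
      (fderiv ℝ (sideParam lam i s) u (Pi.single a 1))
      (fderiv ℝ (sideParam lam i s) u (Pi.single b 1))) =
      Matrix.diagonal fun a => Real.exp (-(lam a * y)) ^ 2 *
        (if a = i then c ^ 2 * (1 + 4 / lam i ^ 2 * Real.exp (lam i * y)) else 1) := by
    ext a b
    rw [(hasFDerivAt_sideParam i s u).fderiv]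
    have hexp : ∀ a, Real.exp (-2 * lam a * y) = Real.exp (-(lam a * y)) ^ 2 := fun a => by
      rw [← Real.exp_nat_mul]; push_cast; ring_nf
    simp only [metric, Matrix.of_apply, ContinuousLinearMap.prod_apply, sideDeriv, diagCLM_single,
      ContinuousLinearMap.proj_apply, sideParam, ← hy, ← hc, hexp]
    rcases eq_or_ne a b with rfl | hab
    · rw [Matrix.diagonal_apply_eq, Finset.sum_eq_single a (fun k _ hk => by simp [hk])
        (by simp)]
      rcases eq_or_ne a i with rfl | hai
      · have e1 : Real.exp (lam a * y / 2) ^ 2 = Real.exp (lam a * y) := by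
          rw [← Real.exp_nat_mul]; push_cast; ring_nf
        have e2 : Real.exp (-(lam a * y)) * Real.exp (lam a * y) = 1 := by
          rw [← Real.exp_add]; simp
        have e3 : c ^ 2 = lam a ^ 2 / 4 * Real.exp (lam a * y) := by
          rw [hc, mul_pow, mul_pow, hs2, e1]; ring
        simp only [Pi.single_eq_same, Function.update_self, if_true, ← sq, e3]
        field_simp
        linear_combination (-4 : ℝ) * (Real.exp (-(lam a * y)) * Real.exp (lam a * y) + 1) * e2
      · simp [hai, hai.symm]
    · rw [Matrix.diagonal_apply_ne _ hab, Finset.sum_eq_zero]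
      · rcases eq_or_ne a i with rfl | hai
        · simp [hab]
        · simp [hai.symm]
      · intro k _
        rcases eq_or_ne k a with rfl | hk
        · simp [hab]
        · simp [hk]
  rw [volumeDensity, hG, Matrix.det_diagonal, Finset.prod_mul_distrib, Finset.prod_pow,
    Finset.prod_ite_eq' Finset.univ i, if_pos (Finset.mem_univ i), abs_det_sideDeriv hpos i hs,
    graphDensity, mul_left_comm, Real.sqrt_mul (sq_nonneg c), Real.sqrt_sq_eq_abs,
    Real.sqrt_mul (sq_nonneg _), Real.sqrt_sq (by positivity)]
  have hcabs : |c| = lam i / 2 * Real.exp (lam i * y / 2) := by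
    rw [hc, abs_mul, abs_mul, hs, one_mul, abs_of_pos (half_pos hpi), Real.abs_exp]
  rw [hcabs]
  ring

theorem continuous_sideParam (i : Fin d) (s : ℝ) : Continuous (sideParam lam i s) :=
  continuous_iff_continuousAt.mpr fun u => (hasFDerivAt_sideParam i s u).continuousAt

theorem isClosed_sideDomain (lam : Fin d → ℝ) (i : Fin d) : IsClosed (sideDomain lam i) := by
  have : sideDomain lam i = {u | u i ≤ 0} ∩ ⋂ j, ⋂ _ : j ≠ i,
      {u : Fin d → ℝ | Real.exp (-(lam j * u i / 2)) * |u j| ≤ 1} := by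
    ext u; simp [sideDomain]
  rw [this]
  exact (isClosed_le (by fun_prop) continuous_const).inter
    (isClosed_iInter fun j => isClosed_iInter fun _ => isClosed_le (by fun_prop) continuous_const)

theorem sideParam_snd_injective (hpos : ∀ i, 0 < lam i) (i : Fin d) {s : ℝ} (hs : |s| = 1) :
    Function.Injective fun u => (sideParam lam i s u).2 := by
  intro u u' h
  have hs0 : s ≠ 0 := by rintro rfl; simp at hs
  ext j
  have hj := congrFun h j
  rcases eq_or_ne j i with rfl | hji
  · simp only [sideParam, Function.update_self] at hj
    have := Real.exp_injective (mul_left_cancel₀ hs0 hj)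
    have hp := hpos j
    have h2 : lam j * u j = lam j * u' j := by linarith
    exact mul_left_cancel₀ hp.ne' h2
  · simpa only [sideParam, Function.update_of_ne hji] using hj

/-- The projection to the `x`-coordinates of the part of a lateral face that lies in `S`. -/
def sideImage (lam : Fin d → ℝ) (i : Fin d) (s : ℝ) (S : Set (Point d)) : Set (Fin d → ℝ) :=
  (fun u => (sideParam lam i s u).2) '' (sideDomain lam i ∩ sideParam lam i s ⁻¹' S)

theorem measurableSet_sideImage (hpos : ∀ i, 0 < lam i) (i : Fin d) {s : ℝ} (hs : |s| = 1)
    {S : Set (Point d)} (hS : MeasurableSet S) : MeasurableSet (sideImage lam i s S) :=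
  ((isClosed_sideDomain lam i).measurableSet.inter
    ((continuous_sideParam i s).measurable hS)).image_of_continuousOn_injOn
    (continuous_snd.comp (continuous_sideParam i s)).continuousOn
    (sideParam_snd_injective hpos i hs).injOn

theorem pieceVolume_sideParam (hpos : ∀ i, 0 < lam i) (i : Fin d) {s : ℝ} (hs : |s| = 1)
    {S : Set (Point d)} (hS : MeasurableSet S) :
    pieceVolume lam (sideParam lam i s) (sideDomain lam i) S =
      ∫⁻ u in sideDomain lam i ∩ sideParam lam i s ⁻¹' S,
        ENNReal.ofReal |(sideDeriv lam i s (u i)).det| *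
          ENNReal.ofReal (graphDensity lam i (u i)) := by
  have hm : MeasurableSet (sideParam lam i s ⁻¹' S) := (continuous_sideParam i s).measurable hS
  rw [pieceVolume, Measure.map_apply (continuous_sideParam i s).measurable hS,
    withDensity_apply _ hm, Measure.restrict_restrict hm, inter_comm]
  simp only [volumeDensity_sideParam hpos i hs, ENNReal.ofReal_mul (abs_nonneg _)]

theorem volume_sideImage (hpos : ∀ i, 0 < lam i) (i : Fin d) {s : ℝ} (hs : |s| = 1)
    {S : Set (Point d)} (hS : MeasurableSet S) :
    volume (sideImage lam i s S) = ∫⁻ u in sideDomain lam i ∩ sideParam lam i s ⁻¹' S,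
        ENNReal.ofReal |(sideDeriv lam i s (u i)).det| :=
  (lintegral_abs_det_fderiv_eq_addHaar_image volume
    ((isClosed_sideDomain lam i).measurableSet.inter ((continuous_sideParam i s).measurable hS))
    (fun u _ => (hasFDerivAt_sideParam_snd i s u).hasFDerivWithinAt)
    (sideParam_snd_injective hpos i hs).injOn).symm

theorem mem_lowerSheet_sideParam {i : Fin d} {s : ℝ} (hs : |s| = 1) {u : Fin d → ℝ}
    (hu : u ∈ sideDomain lam i) : sideParam lam i s u ∈ lowerSheet lam := by
  refine ⟨hu.1, fun j => ?_, i, by simp [sideParam, abs_mul, hs]⟩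
  rcases eq_or_ne j i with rfl | hji
  · simp [sideParam, abs_mul, hs]
  · simpa [sideParam, hji, exp_neg_mul_le_one_iff] using hu.2 j hji

theorem pieceVolume_sideParam_le (hpos : ∀ i, 0 < lam i) (i : Fin d) {s : ℝ} (hs : |s| = 1)
    {S : Set (Point d)} (hS : MeasurableSet S) {M : ℝ}
    (hM : ∀ q ∈ S ∩ lowerSheet lam, graphDensity lam i q.1 ≤ M) :
    pieceVolume lam (sideParam lam i s) (sideDomain lam i) S ≤
      ENNReal.ofReal M * volume (sideImage lam i s S) := by
  rw [pieceVolume_sideParam hpos i hs hS, volume_sideImage hpos i hs hS,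
    ← lintegral_const_mul' _ _ ENNReal.ofReal_ne_top]
  refine setLIntegral_mono' ((isClosed_sideDomain lam i).measurableSet.inter
    ((continuous_sideParam i s).measurable hS)) fun u hu => ?_
  rw [mul_comm]
  gcongr
  exact hM _ ⟨hu.2, mem_lowerSheet_sideParam hs hu.1⟩

theorem le_pieceVolume_sideParam (hpos : ∀ i, 0 < lam i) (i : Fin d) {s : ℝ} (hs : |s| = 1)
    {S : Set (Point d)} (hS : MeasurableSet S) {m : ℝ}
    (hm : ∀ q ∈ S ∩ lowerSheet lam, m ≤ graphDensity lam i q.1) :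
    ENNReal.ofReal m * volume (sideImage lam i s S) ≤
      pieceVolume lam (sideParam lam i s) (sideDomain lam i) S := by
  rw [pieceVolume_sideParam hpos i hs hS, volume_sideImage hpos i hs hS,
    ← lintegral_const_mul' _ _ ENNReal.ofReal_ne_top]
  refine setLIntegral_mono' ((isClosed_sideDomain lam i).measurableSet.inter
    ((continuous_sideParam i s).measurable hS)) fun u hu => ?_
  rw [mul_comm]
  gcongr
  exact hm _ ⟨hu.2, mem_lowerSheet_sideParam hs hu.1⟩

theorem fst_eq_of_mem_lowerSheet (hpos : ∀ i, 0 < lam i) {y y' : ℝ} {x : Fin d → ℝ}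
    (h : (y, x) ∈ lowerSheet lam) (h' : (y', x) ∈ lowerSheet lam) : y = y' := by
  have key : ∀ {y y' : ℝ}, (y, x) ∈ lowerSheet lam → (y', x) ∈ lowerSheet lam → y ≤ y' := by
    intro y y' h h'
    obtain ⟨i, hi⟩ := h.2.2
    have hle := h'.2.1 i
    simp only at hi hle
    rw [hi, Real.exp_le_exp] at hle
    have hpi := hpos i
    refine le_of_mul_le_mul_left (by linarith : lam i * y ≤ lam i * y') hpi
  exact le_antisymm (key h h') (key h' h)

theorem sideImage_subset {i : Fin d} {s : ℝ} (hs : |s| = 1) {S : Set (Point d)}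
    {A : Set (Fin d → ℝ)} (hA : ∀ q ∈ S ∩ lowerSheet lam, q.2 ∈ A) : sideImage lam i s S ⊆ A := by
  rintro _ ⟨u, hu, rfl⟩
  exact hA _ ⟨hu.2, mem_lowerSheet_sideParam hs hu.1⟩

theorem exists_mem_sideImage {S : Set (Point d)} {q : Point d} (hq : q ∈ S)
    (hq' : q ∈ lowerSheet lam) : ∃ i, q.2 ∈ sideImage lam i 1 S ∪ sideImage lam i (-1) S := by
  obtain ⟨h0, h1, i, hi⟩ := hq'
  refine ⟨i, ?_⟩
  have key : ∀ s : ℝ, q.2 i = s * Real.exp (lam i * q.1 / 2) → q.2 ∈ sideImage lam i s S := by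
    intro s hs
    have hpar : sideParam lam i s (Function.update q.2 i q.1) = q := by
      refine Prod.ext (by simp [sideParam]) ?_
      simp only [sideParam, Function.update_self, ← hs, Function.update_idem,
        Function.update_eq_self]
    refine ⟨Function.update q.2 i q.1, ⟨⟨by simpa using h0, fun j hj => ?_⟩, ?_⟩, ?_⟩
    · simpa [hj, exp_neg_mul_le_one_iff] using h1 j
    · rwa [mem_preimage, hpar]
    · simp only [hpar]
  rcases abs_choice (q.2 i) with h | h
  · exact Or.inl (key 1 (by rw [one_mul, ← hi, h]))
  · exact Or.inr (key (-1) (by rw [← hi, h]; ring))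

theorem volume_edge_eq_zero {i j : Fin d} (hij : i ≠ j) :
    volume {u : Fin d → ℝ | |u j| = Real.exp (lam j * u i / 2)} = 0 := by
  have hplane : volume {v : Fin d → ℝ | v j = 0} = 0 := Measure.pi_hyperplane (fun _ => volume) j 0
  let g : ℝ → (Fin d → ℝ) → Fin d → ℝ := fun s v =>
    v + (s * Real.exp (lam j * v i / 2)) • Pi.single j 1
  have hg : ∀ s, volume (g s '' {v | v j = 0}) = 0 := fun s =>
    addHaar_image_eq_zero_of_differentiableOn_of_addHaar_eq_zero _ (by fun_prop) hplane
  refine measure_mono_null ?_ (measure_union_null (hg 1) (hg (-1)))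
  intro u hu
  have key : ∀ s : ℝ, u j = s * Real.exp (lam j * u i / 2) → u ∈ g s '' {v | v j = 0} := by
    intro s hs
    refine ⟨Function.update u j 0, by simp, ?_⟩
    ext k
    rcases eq_or_ne k j with rfl | hk
    · simp [g, hij, hs]
    · simp [g, hk]
  rcases abs_choice (u j) with h | h
  · exact Or.inl (key 1 (by rw [one_mul, ← hu, h]))
  · exact Or.inr (key (-1) (by rw [← hu, h]; ring))

theorem aedisjoint_sideImage (hpos : ∀ i, 0 < lam i) {i j : Fin d} (hij : i ≠ j) {s s' : ℝ}
    (hs : |s| = 1) (hs' : |s'| = 1) (S : Set (Point d)) :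
    AEDisjoint volume (sideImage lam i s S) (sideImage lam j s' S) := by
  refine measure_mono_null ?_ (addHaar_image_eq_zero_of_differentiableOn_of_addHaar_eq_zero volume
    (fun u _ => (hasFDerivAt_sideParam_snd (lam := lam) i s u).differentiableAt
      |>.differentiableWithinAt) (volume_edge_eq_zero (lam := lam) hij))
  rintro _ ⟨⟨u, hu, rfl⟩, ⟨u', hu', h⟩⟩
  refine ⟨u, ?_, rfl⟩
  have h1 := mem_lowerSheet_sideParam hs hu.1
  have h2 := mem_lowerSheet_sideParam hs' hu'.1
  have hy : u' j = u i := by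
    have h3 : (u' j, (sideParam lam i s u).2) ∈ lowerSheet lam := by
      simp only at h
      rw [← h]; exact h2
    exact fst_eq_of_mem_lowerSheet hpos h3 h1
  have h4 := congrFun h j
  simp only [sideParam, Function.update_self, Function.update_of_ne hij.symm] at h4
  rw [mem_ofPred_eq, ← h4, abs_mul, hs', hy, one_mul, Real.abs_exp]

theorem sum_volume_sideImage_le (hpos : ∀ i, 0 < lam i) {S : Set (Point d)}
    (hS : MeasurableSet S) {A : Set (Fin d → ℝ)} (hA : ∀ q ∈ S ∩ lowerSheet lam, q.2 ∈ A) :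
    ∑ i, (volume (sideImage lam i 1 S) + volume (sideImage lam i (-1) S)) ≤ volume A := by
  have h1 : |(1 : ℝ)| = 1 := abs_one
  have h2 : |(-1 : ℝ)| = 1 := by simp
  have hdisj : ∀ i, Disjoint (sideImage lam i 1 S) (sideImage lam i (-1) S) := by
    intro i
    rw [Set.disjoint_left]
    rintro _ ⟨u, -, rfl⟩ ⟨u', -, h⟩
    have := congrFun h i
    simp only [sideParam, Function.update_self] at this
    linarith [Real.exp_pos (lam i * u i / 2), Real.exp_pos (lam i * u' i / 2)]
  calc ∑ i, (volume (sideImage lam i 1 S) + volume (sideImage lam i (-1) S))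
      = ∑ i, volume (sideImage lam i 1 S ∪ sideImage lam i (-1) S) :=
        Finset.sum_congr rfl fun i _ =>
          (measure_union (hdisj i) (measurableSet_sideImage hpos i h2 hS)).symm
    _ = volume (⋃ i ∈ Finset.univ, (sideImage lam i 1 S ∪ sideImage lam i (-1) S)) := by
        refine (measure_biUnion_finset₀ (fun i _ j _ hij => ?_) fun i _ => ?_).symm
        · simp only [Function.onFun, AEDisjoint.union_left_iff, AEDisjoint.union_right_iff]
          exact ⟨⟨aedisjoint_sideImage hpos hij h1 h1 S, aedisjoint_sideImage hpos hij h2 h1 S⟩,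
            aedisjoint_sideImage hpos hij h1 h2 S, aedisjoint_sideImage hpos hij h2 h2 S⟩
        · exact ((measurableSet_sideImage hpos i h1 hS).union
            (measurableSet_sideImage hpos i h2 hS)).nullMeasurableSet
    _ ≤ volume A := by
        refine measure_mono (iUnion₂_subset fun i _ => union_subset ?_ ?_)
        · exact sideImage_subset h1 hA
        · exact sideImage_subset h2 hA

theorem pieceVolume_baseParam {S : Set (Point d)} (hS : MeasurableSet S) :
    pieceVolume lam (baseParam d) (baseDomain d) S =
      volume (baseDomain d ∩ baseParam d ⁻¹' S) := by
  have hder : ∀ x, HasFDerivAt (baseParam d) (ContinuousLinearMap.inr ℝ ℝ (Fin d → ℝ)) x :=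
    fun x => (ContinuousLinearMap.inr ℝ ℝ (Fin d → ℝ)).hasFDerivAt
  have hmeas : Measurable (baseParam d) := measurable_const.prodMk measurable_id
  have hden : ∀ x, volumeDensity lam (baseParam d) x = 1 := by
    intro x
    have : (Matrix.of fun a b : Fin d => metric lam (baseParam d x)
        (fderiv ℝ (baseParam d) x (Pi.single a 1)) (fderiv ℝ (baseParam d) x (Pi.single b 1))) =
        1 := by
      ext a b
      rw [(hder x).fderiv]
      simp [metric, baseParam, Matrix.one_apply, Pi.single_apply, eq_comm]
    rw [volumeDensity, this, Matrix.det_one, Real.sqrt_one]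
  have hm := hmeas hS
  rw [pieceVolume, Measure.map_apply hmeas hS, withDensity_apply _ hm,
    Measure.restrict_restrict hm, inter_comm]
  simp [hden]

theorem horosphereVolume_apply (S : Set (Point d)) :
    horosphereVolume lam S = pieceVolume lam (baseParam d) (baseDomain d) S +
      ∑ i, (pieceVolume lam (sideParam lam i 1) (sideDomain lam i) S +
        pieceVolume lam (sideParam lam i (-1)) (sideDomain lam i) S) := by
  simp [horosphereVolume]

theorem horosphereVolume_le (hpos : ∀ i, 0 < lam i) {S : Set (Point d)} (hS : MeasurableSet S)
    {M : ℝ} (hM : ∀ q ∈ S ∩ lowerSheet lam, ∀ i, graphDensity lam i q.1 ≤ M)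
    {A : Set (Fin d → ℝ)} (hA : ∀ q ∈ S ∩ lowerSheet lam, q.2 ∈ A) :
    horosphereVolume lam S ≤
      volume (baseDomain d ∩ baseParam d ⁻¹' S) + ENNReal.ofReal M * volume A := by
  rw [horosphereVolume_apply, pieceVolume_baseParam hS]
  gcongr
  refine le_trans ?_ (mul_le_mul_right (sum_volume_sideImage_le hpos hS hA) _)
  rw [Finset.mul_sum]
  refine Finset.sum_le_sum fun i _ => ?_
  rw [mul_add]
  exact add_le_add (pieceVolume_sideParam_le hpos i abs_one hS fun q hq => hM q hq i)
    (pieceVolume_sideParam_le hpos i (by simp) hS fun q hq => hM q hq i)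

theorem le_horosphereVolume (hpos : ∀ i, 0 < lam i) {S : Set (Point d)} (hS : MeasurableSet S)
    {m : ℝ} (hm : ∀ q ∈ S ∩ lowerSheet lam, m ≤ ∏ j, Real.exp (-(lam j * q.1)))
    {A : Set (Fin d → ℝ)} (hA : ∀ x ∈ A, ∃ y, (y, x) ∈ S ∩ lowerSheet lam) :
    ENNReal.ofReal m * volume A ≤ horosphereVolume lam S := by
  have hm' : ∀ i, ∀ q ∈ S ∩ lowerSheet lam, m ≤ graphDensity lam i q.1 := by
    intro i q hq
    refine (hm q hq).trans (le_mul_of_one_le_left (by positivity) ?_)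
    rw [Real.one_le_sqrt]
    have := hpos i
    have : 0 ≤ 4 / lam i ^ 2 * Real.exp (lam i * q.1) := by positivity
    linarith
  have hcover : A ⊆ ⋃ i ∈ Finset.univ, (sideImage lam i 1 S ∪ sideImage lam i (-1) S) := by
    intro x hx
    obtain ⟨y, hy, hy'⟩ := hA x hx
    obtain ⟨i, hi⟩ := exists_mem_sideImage hy hy'
    exact mem_iUnion₂.mpr ⟨i, Finset.mem_univ i, hi⟩
  rw [horosphereVolume_apply]
  refine le_add_left (le_trans (mul_le_mul_right ((measure_mono hcover).trans
    (measure_biUnion_finset_le _ _)) _) ?_)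
  rw [Finset.mul_sum]
  refine Finset.sum_le_sum fun i _ => ?_
  refine (mul_le_mul_right (measure_union_le _ _) _).trans ?_
  rw [mul_add]
  exact add_le_add (le_pieceVolume_sideParam hpos i abs_one hS (hm' i))
    (le_pieceVolume_sideParam hpos i (by simp) hS (hm' i))

theorem le_horosphereVolume_base {S : Set (Point d)} (hS : MeasurableSet S) :
    volume (baseDomain d ∩ baseParam d ⁻¹' S) ≤ horosphereVolume lam S := by
  rw [horosphereVolume_apply, pieceVolume_baseParam hS]
  exact le_self_add

theorem volume_scaled_preimage (y : ℝ) (s : Set (EuclideanSpace ℝ (Fin d)))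
    (hs : MeasurableSet s) :
    volume (scaled lam y ⁻¹' s) = ENNReal.ofReal (∏ i, Real.exp (lam i * y)) * volume s := by
  have h1 : scaled lam y ⁻¹' s = diagCLM (fun i => Real.exp (-(lam i * y))) ⁻¹'
      (WithLp.toLp 2 ⁻¹' s) := by
    ext x
    simp only [mem_preimage]
    have : scaled lam y x = WithLp.toLp 2 (diagCLM (fun i => Real.exp (-(lam i * y))) x) := by
      ext i; simp [diagCLM_apply]
    rw [this]
  have hdet : (diagCLM fun i => Real.exp (-(lam i * y))).det ≠ 0 := by
    rw [det_diagCLM]; positivity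
  rw [h1, Measure.addHaar_preimage_continuousLinearMap _ hdet,
    (PiLp.volume_preserving_toLp (Fin d)).measure_preimage hs.nullMeasurableSet,
    ← ContinuousLinearMap.det, det_diagCLM,
    ← Finset.prod_inv_distrib, abs_of_nonneg (by positivity)]
  simp only [← Real.exp_neg, neg_neg]

theorem volume_closedBall_eq (z : EuclideanSpace ℝ (Fin d)) {r : ℝ} (hr : 0 ≤ r) :
    volume (Metric.closedBall z r) = ENNReal.ofReal (unitBallVolume d * r ^ d) := by
  rw [Measure.addHaar_closedBall _ _ hr, finrank_euclideanSpace_fin, mul_comm (unitBallVolume d),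
    ENNReal.ofReal_mul (by positivity), unitBallVolume,
    ENNReal.ofReal_toReal measure_ball_lt_top.ne]

theorem volume_ball_eq [NeZero d] (z : EuclideanSpace ℝ (Fin d)) {r : ℝ} (hr : 0 ≤ r) :
    volume (Metric.ball z r) = ENNReal.ofReal (unitBallVolume d * r ^ d) := by
  rw [← volume_closedBall_eq z hr, Measure.addHaar_closedBall _ _ hr, Measure.addHaar_ball _ _ hr]

theorem unitBallVolume_pos (d : ℕ) : 0 < unitBallVolume d :=
  ENNReal.toReal_pos (Metric.measure_ball_pos _ _ one_pos).ne' measure_ball_lt_top.ne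

theorem mem_scaled_preimage_closedBall {y ρ : ℝ} {x x₀ : Fin d → ℝ} :
    x ∈ scaled lam y ⁻¹' Metric.closedBall (scaled lam y x₀) ρ ↔ ‖scaled lam y (x - x₀)‖ ≤ ρ := by
  rw [mem_preimage, Metric.mem_closedBall, dist_eq_norm, map_sub]

theorem mem_scaled_preimage_ball {y ρ : ℝ} {x x₀ : Fin d → ℝ} :
    x ∈ scaled lam y ⁻¹' Metric.ball (scaled lam y x₀) ρ ↔ ‖scaled lam y (x - x₀)‖ < ρ := by
  rw [mem_preimage, Metric.mem_ball, dist_eq_norm, map_sub]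

theorem measurable_scaled (y : ℝ) : Measurable (scaled lam y) :=
  (LinearMap.continuous_of_finiteDimensional _).measurable

theorem prod_exp_cancel (lam : Fin d → ℝ) (y t : ℝ) :
    (∏ j, Real.exp (-(lam j * (y + t)))) * ∏ j, Real.exp (lam j * y) =
      ∏ j, Real.exp (-(lam j * t)) := by
  rw [← Finset.prod_mul_distrib]
  refine Finset.prod_congr rfl fun j _ => ?_
  rw [← Real.exp_add]; ring_nf

theorem prod_exp_antitone (hpos : ∀ i, 0 < lam i) {y y' : ℝ} (h : y ≤ y') :
    ∏ j, Real.exp (-(lam j * y')) ≤ ∏ j, Real.exp (-(lam j * y)) :=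
  Finset.prod_le_prod (fun _ _ => (Real.exp_pos _).le) fun j _ =>
    Real.exp_le_exp.mpr (by nlinarith [hpos j])

theorem exists_small (lam : Fin d → ℝ) (Λ r R : ℝ) {ε : ℝ} (hε : 0 < ε) :
    ∃ σ : ℝ, 0 < σ ∧ σ * R < 1 ∧ σ * r < 1 ∧
      Real.sqrt (1 + σ) * (∏ j, Real.exp (-(lam j * -(σ * R)))) *
        Real.exp (Λ * (σ * R)) ^ d ≤ 1 + ε ∧
      1 - ε ≤ (∏ j, Real.exp (-(lam j * (σ * r)))) /
        Real.sqrt (σ ^ 2 + Real.exp (Λ * (σ * r)) ^ 2) ^ d := by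
  have h1 : ∀ᶠ σ in nhds (0 : ℝ), σ * R < 1 :=
    (by fun_prop : ContinuousAt (fun σ : ℝ => σ * R) 0).eventually_lt_const (by simp)
  have h2 : ∀ᶠ σ in nhds (0 : ℝ), σ * r < 1 :=
    (by fun_prop : ContinuousAt (fun σ : ℝ => σ * r) 0).eventually_lt_const (by simp)
  have h3 : ∀ᶠ σ in nhds (0 : ℝ), Real.sqrt (1 + σ) * (∏ j, Real.exp (-(lam j * -(σ * R)))) *
        Real.exp (Λ * (σ * R)) ^ d < 1 + ε :=
    (by fun_prop : ContinuousAt (fun σ : ℝ => Real.sqrt (1 + σ) *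
      (∏ j, Real.exp (-(lam j * -(σ * R)))) * Real.exp (Λ * (σ * R)) ^ d) 0).eventually_lt_const
        (by simpa using hε)
  have h4 : ∀ᶠ σ in nhds (0 : ℝ), 1 - ε < (∏ j, Real.exp (-(lam j * (σ * r)))) /
        Real.sqrt (σ ^ 2 + Real.exp (Λ * (σ * r)) ^ 2) ^ d := by
    have hc : ContinuousAt (fun σ : ℝ => (∏ j, Real.exp (-(lam j * (σ * r)))) /
        Real.sqrt (σ ^ 2 + Real.exp (Λ * (σ * r)) ^ 2) ^ d) 0 :=
      ContinuousAt.div (by fun_prop) (by fun_prop) (by simp)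
    exact hc.eventually_const_lt (by simpa using hε)
  obtain ⟨σ, ⟨a1, a2, a3, a4⟩, hσ⟩ :=
    (((h1.and (h2.and (h3.and h4))).filter_mono nhdsWithin_le_nhds).and
      (self_mem_nhdsWithin (s := Ioi (0 : ℝ)))).exists
  exact ⟨σ, hσ, a1, a2, a3.le, a4.le⟩

theorem exists_depth (hpos : ∀ i, 0 < lam i) (r : ℝ) {σ : ℝ} (hσ : 0 < σ) :
    ∃ y₀ : ℝ, y₀ < -1 ∧ y₀ + r < 0 ∧ ∀ y ≤ y₀, ∀ i,
      2 / lam i * Real.exp (lam i / 2) * Real.exp (lam i * y / 2) ≤ σ ∧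
      4 / lam i ^ 2 * Real.exp (lam i * (y + 1)) ≤ σ := by
  have hlim : ∀ a b : ℝ, 0 < b → Filter.Tendsto (fun y => a * Real.exp (b * y))
      Filter.atBot (nhds 0) := fun a b hb => by
    simpa using (Real.tendsto_exp_atBot.comp
      (Filter.tendsto_id.const_mul_atBot hb)).const_mul a
  have h : ∀ᶠ y in Filter.atBot, ∀ i,
      2 / lam i * Real.exp (lam i / 2) * Real.exp (lam i * y / 2) ≤ σ ∧
      4 / lam i ^ 2 * Real.exp (lam i * (y + 1)) ≤ σ := by
    refine Filter.eventually_all.mpr fun i => ?_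
    have hpi := hpos i
    filter_upwards [(hlim (2 / lam i * Real.exp (lam i / 2)) (lam i / 2)
      (half_pos hpi)).eventually_le_const hσ, (hlim (4 / lam i ^ 2 * Real.exp (lam i)) (lam i)
      hpi).eventually_le_const hσ] with y h1 h2
    refine ⟨by rwa [mul_div_right_comm (lam i) y], ?_⟩
    rwa [mul_add, mul_one, Real.exp_add, mul_comm (Real.exp _), ← mul_assoc]
  obtain ⟨y₁, hy₁⟩ := Filter.eventually_atBot.mp h
  refine ⟨min y₁ (min (-2) (-r - 1)), ?_, ?_, fun y hy => hy₁ y (hy.trans (min_le_left _ _))⟩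
  · have := (min_le_right y₁ _).trans (min_le_left (-2) (-r - 1)); linarith
  · have := (min_le_right y₁ _).trans (min_le_right (-2) (-r - 1)); linarith

theorem horosphereVolume_ball_le [NeZero d] (hpos : ∀ i, 0 < lam i) {Λ : ℝ}
    (hΛ : ∀ i, lam i ≤ Λ) {σ r : ℝ} (hr : 0 < r) {p : Point d}
    (hp : p ∈ approxHorosphere lam) (hp1 : p.1 < -1) (hpr : p.1 + r < 0)
    (hκ : ∀ i, 2 / lam i * Real.exp (lam i / 2) * Real.exp (lam i * p.1 / 2) ≤ σ)
    (hτ : ∀ i, 4 / lam i ^ 2 * Real.exp (lam i * (p.1 + 1)) ≤ σ)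
    (h1 : σ * (Real.exp (Λ * r) * r) < 1) :
    horosphereVolume lam (intrinsicBall lam (approxHorosphere lam) p r) ≤
      ENNReal.ofReal (Real.sqrt (1 + σ) *
        (∏ j, Real.exp (-(lam j * -(σ * (Real.exp (Λ * r) * r))))) *
        Real.exp (Λ * (σ * (Real.exp (Λ * r) * r))) ^ d * (unitBallVolume d * r ^ d)) := by
  set δ := σ * (Real.exp (Λ * r) * r) with hδ
  set A := scaled lam p.1 ⁻¹' Metric.closedBall (scaled lam p.1 p.2) (Real.exp (Λ * δ) * r) with hA
  set S : Set (Point d) := (fun q => |q.1 - p.1|) ⁻¹' Iic δ ∩ Prod.snd ⁻¹' A with hS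
  have hSm : MeasurableSet S :=
    ((by fun_prop : Measurable fun q : Point d => |q.1 - p.1|) measurableSet_Iic).inter
      (measurable_snd (measurable_scaled _ measurableSet_closedBall))
  have hsub : intrinsicBall lam (approxHorosphere lam) p r ⊆ S := fun q hq => by
    have h := mem_ball_bounds hpos hΛ hr hp hpr hκ h1 hq
    exact ⟨h.1, mem_scaled_preimage_closedBall.mpr h.2⟩
  have hbase : baseDomain d ∩ baseParam d ⁻¹' S = ∅ := by
    refine eq_empty_of_forall_notMem fun x hx => ?_
    have h : |(0 : ℝ) - p.1| ≤ δ := hx.2.1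
    rw [zero_sub, abs_neg] at h
    linarith [neg_le_of_abs_le h]
  have hM : ∀ q ∈ S ∩ lowerSheet lam, ∀ i, graphDensity lam i q.1 ≤
      Real.sqrt (1 + σ) * ∏ j, Real.exp (-(lam j * (p.1 + -δ))) := by
    intro q hq i
    have hqp := abs_le.mp (show |q.1 - p.1| ≤ δ from hq.1.1)
    refine mul_le_mul (Real.sqrt_le_sqrt ?_) (prod_exp_antitone hpos (by linarith))
      (by positivity) (by positivity)
    have hpi := hpos i
    have h2 := hτ i
    have h3 : Real.exp (lam i * q.1) ≤ Real.exp (lam i * (p.1 + 1)) := by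
      gcongr; linarith
    have h4 : 4 / lam i ^ 2 * Real.exp (lam i * q.1) ≤
      4 / lam i ^ 2 * Real.exp (lam i * (p.1 + 1)) := by gcongr
    linarith
  refine (measure_mono hsub).trans ((horosphereVolume_le hpos hSm hM (A := A)
    fun q hq => hq.1.2).trans ?_)
  rw [hbase, measure_empty, zero_add, hA, volume_scaled_preimage _ _ measurableSet_closedBall,
    volume_closedBall_eq _ (by positivity), ← ENNReal.ofReal_mul (by positivity),
    ← ENNReal.ofReal_mul (by positivity)]
  refine (congrArg _ ?_).le
  rw [← prod_exp_cancel lam p.1 (-δ), mul_pow]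
  ring

theorem le_horosphereVolume_ball [NeZero d] (hpos : ∀ i, 0 < lam i) {Λ : ℝ}
    (hΛ : ∀ i, lam i ≤ Λ) {κ ρ r : ℝ} {p : Point d} (hp : p ∈ lowerSheet lam)
    (hκ : ∀ i, 2 / lam i * Real.exp (lam i / 2) * Real.exp (lam i * p.1 / 2) ≤ κ)
    (h1 : κ * ρ < 1) (hr : 0 < r)
    (hC : Real.sqrt (κ ^ 2 + Real.exp (Λ * (κ * ρ)) ^ 2) * ρ ≤ r)
    {A : Set (Fin d → ℝ)} (hAm : MeasurableSet A)
    (hA : ∀ x ∈ A, ‖scaled lam p.1 (x - p.2)‖ < ρ)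
    (hA0 : p.1 + κ * ρ ≤ 0 ∨ ∀ x ∈ A, ∀ i, |x i| ≤ 1) :
    ENNReal.ofReal (∏ j, Real.exp (-(lam j * (p.1 + κ * ρ)))) * volume A ≤
      horosphereVolume lam (intrinsicBall lam (approxHorosphere lam) p r) := by
  have hκ0 : 0 ≤ κ := by
    have := hpos 0
    exact le_trans (by positivity) (hκ 0)
  have hκN : ∀ x ∈ A, κ * ‖scaled lam p.1 (x - p.2)‖ ≤ κ * ρ := fun x hx =>
    mul_le_mul_of_nonneg_left (hA x hx).le hκ0
  have hsub : lowerSheet lam ∩ Prod.snd ⁻¹' A ⊆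
      intrinsicBall lam (approxHorosphere lam) p r := fun q hq => by
    refine ⟨lowerSheet_subset hq.1, (inducedDist_le_of_mem_lowerSheet hpos hΛ hp hq.1 hκ
      (hA _ hq.2).le h1).trans_lt ((ENNReal.ofReal_lt_ofReal_iff hr).mpr (lt_of_lt_of_le ?_ hC))⟩
    have := hA _ hq.2
    gcongr
  refine le_trans (le_horosphereVolume hpos
    ((isClosed_lowerSheet lam).measurableSet.inter (measurable_snd hAm)) (fun q hq => ?_)
    fun x hx => ?_) (measure_mono hsub)
  · refine prod_exp_antitone hpos ?_
    have h := abs_fst_sub_le_of_mem_lowerSheet hpos hp hq.2 hκ ((hκN _ hq.1.2).trans_lt h1)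
    linarith [le_of_abs_le h, hκN _ hq.1.2]
  · obtain ⟨y, hy⟩ := exists_mem_lowerSheet hpos hp hκ ((hκN x hx).trans_lt h1)
      (hA0.imp (fun h => by linarith [hκN x hx]) fun h => h x hx)
    exact ⟨y, ⟨hy, hx⟩, hy⟩

theorem volume_ball_asymptotics [NeZero d] (hpos : ∀ i, 0 < lam i) {ε r : ℝ} (hε : 0 < ε)
    (hr : 0 < r) : ∃ y₀ : ℝ, y₀ < 0 ∧ ∀ p ∈ approxHorosphere lam, p.1 ≤ y₀ →
      ENNReal.ofReal ((1 - ε) * (unitBallVolume d * r ^ d)) ≤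
        horosphereVolume lam (intrinsicBall lam (approxHorosphere lam) p r) ∧
      horosphereVolume lam (intrinsicBall lam (approxHorosphere lam) p r) ≤
        ENNReal.ofReal ((1 + ε) * (unitBallVolume d * r ^ d)) := by
  obtain ⟨Λ, hΛ⟩ : ∃ Λ, ∀ i, lam i ≤ Λ :=
    ⟨∑ i, lam i, fun i => Finset.single_le_sum (fun j _ => (hpos j).le) (Finset.mem_univ i)⟩
  have hω := unitBallVolume_pos d
  obtain ⟨σ, hσ, hσR, hσr, hup, hlow⟩ := exists_small lam Λ r (Real.exp (Λ * r) * r) hε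
  obtain ⟨y₀, hy1, hyr, hy⟩ := exists_depth hpos r hσ
  refine ⟨y₀, by linarith, fun p hp hpy => ⟨?_, ?_⟩⟩
  · set C := Real.sqrt (σ ^ 2 + Real.exp (Λ * (σ * r)) ^ 2) with hC
    have hC1 : 1 ≤ C := by
      have hΛ0 : 0 < Λ := (hpos 0).trans_le (hΛ 0)
      rw [hC, Real.one_le_sqrt]
      have : 1 ≤ Real.exp (Λ * (σ * r)) := Real.one_le_exp (by positivity)
      nlinarith [sq_nonneg σ]
    have hC0 : 0 < C := by linarith
    have hρr : r / C ≤ r := div_le_self hr.le hC1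
    have hσρ : σ * (r / C) ≤ σ * r := by gcongr
    have hΛ0 : 0 ≤ Λ := (hpos 0).le.trans (hΛ 0)
    have h := le_horosphereVolume_ball hpos hΛ (κ := σ) (ρ := r / C) (r := r)
      (mem_lowerSheet_of_neg hp (by linarith)) (fun i => (hy _ hpy i).1)
      (by linarith) hr
      (by
        calc _ ≤ C * (r / C) := by rw [hC]; gcongr
          _ = r := by field_simp)
      (measurable_scaled p.1 (measurableSet_ball (x := scaled lam p.1 p.2)))
      (fun x hx => mem_scaled_preimage_ball.mp hx) (Or.inl (by linarith))
    refine le_trans ?_ h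
    rw [volume_scaled_preimage _ _ measurableSet_ball, volume_ball_eq _ (by positivity),
      ← ENNReal.ofReal_mul (by positivity), ← ENNReal.ofReal_mul (by positivity),
      ← mul_assoc (∏ j, _) (∏ j, _), prod_exp_cancel]
    apply ENNReal.ofReal_le_ofReal
    calc (1 - ε) * (unitBallVolume d * r ^ d)
        ≤ (∏ j, Real.exp (-(lam j * (σ * r)))) / C ^ d * (unitBallVolume d * r ^ d) := by gcongr
      _ = (∏ j, Real.exp (-(lam j * (σ * r)))) * (unitBallVolume d * (r / C) ^ d) := by
        rw [div_pow]; ring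
      _ ≤ _ := by
        have := prod_exp_antitone hpos hσρ
        gcongr
  · refine (horosphereVolume_ball_le hpos hΛ hr hp (by linarith) (by linarith)
      (fun i => (hy _ hpy i).1) (fun i => (hy _ hpy i).2) hσR).trans (ENNReal.ofReal_le_ofReal ?_)
    gcongr

theorem baseDomain_eq_Icc (d : ℕ) : baseDomain d = Icc (-1) 1 := by
  ext x
  simp [baseDomain, abs_le, Pi.le_def, forall_and]

theorem volume_baseDomain_lt_top (d : ℕ) : volume (baseDomain d) < ⊤ := by
  rw [baseDomain_eq_Icc]; exact isCompact_Icc.measure_lt_top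

theorem exists_le_volume_baseDomain_inter (lam : Fin d → ℝ) {ρ : ℝ} (hρ : 0 < ρ) :
    ∃ v : ℝ, 0 < v ∧ ∀ x₀ ∈ baseDomain d, ENNReal.ofReal v ≤
      volume (baseDomain d ∩ scaled lam 0 ⁻¹' Metric.ball (scaled lam 0 x₀) ρ) := by
  set t := min 1 (ρ / (d + 1)) with ht
  have ht0 : 0 < t := by positivity
  have ht1 : t ≤ 1 := min_le_left _ _
  have htρ : d * t < ρ := by
    have h : t * (d + 1) ≤ ρ := by
      rw [← le_div_iff₀ (by positivity)]; exact min_le_right _ _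
    linarith
  refine ⟨t ^ d, by positivity, fun x₀ hx₀ => ?_⟩
  let a : Fin d → ℝ := fun i => if x₀ i ≤ 0 then x₀ i else x₀ i - t
  have hvol : volume (Icc a fun i => a i + t) = ENNReal.ofReal (t ^ d) := by
    rw [Real.volume_Icc_pi, ENNReal.ofReal_pow ht0.le]
    simp
  rw [← hvol]
  refine measure_mono fun x hx => ?_
  have hx' : ∀ i, |x i| ≤ 1 ∧ |x i - x₀ i| ≤ t := fun i => by
    have h1 := hx.1 i
    have h2 := hx.2 i
    have h3 := abs_le.mp (hx₀ i)
    simp only [a] at h1 h2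
    split_ifs at h1 h2 with h <;>
      exact ⟨abs_le.mpr ⟨by linarith, by linarith⟩, abs_le.mpr ⟨by linarith, by linarith⟩⟩
  refine ⟨fun i => (hx' i).1, mem_scaled_preimage_ball.mpr (lt_of_le_of_lt ?_ htρ)⟩
  refine (sq_le_sq₀ (norm_nonneg _) (by positivity)).mp ?_
  rw [norm_scaled_sq]
  calc ∑ i, Real.exp (-2 * lam i * 0) * ((x - x₀) i * (x - x₀) i)
      ≤ ∑ _i : Fin d, t ^ 2 := Finset.sum_le_sum fun i _ => by
        have := sq_le_sq' (neg_le_of_abs_le (hx' i).2) (le_of_abs_le (hx' i).2)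
        simpa [sq] using this
    _ = d * t ^ 2 := by simp
    _ ≤ (d * t) ^ 2 := by
        rw [mul_pow]
        gcongr
        rcases Nat.eq_zero_or_pos d with h | h
        · simp [h]
        · have : (1 : ℝ) ≤ d := by exact_mod_cast h
          nlinarith

theorem exists_le_volume_ball [NeZero d] (hpos : ∀ i, 0 < lam i) {r : ℝ} (hr : 0 < r) (y₀ : ℝ) :
    ∃ v : ℝ, 0 < v ∧ ∀ p ∈ approxHorosphere lam, y₀ ≤ p.1 → ENNReal.ofReal v ≤
      horosphereVolume lam (intrinsicBall lam (approxHorosphere lam) p r) := by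
  obtain ⟨Λ, hΛ⟩ : ∃ Λ, ∀ i, lam i ≤ Λ :=
    ⟨∑ i, lam i, fun i => Finset.single_le_sum (fun j _ => (hpos j).le) (Finset.mem_univ i)⟩
  have hΛ0 : 0 < Λ := (hpos 0).trans_le (hΛ 0)
  set κ := ∑ i, 2 / lam i * Real.exp (lam i / 2) with hκdef
  have hterm : ∀ i, 0 ≤ 2 / lam i * Real.exp (lam i / 2) := fun i => by
    have := hpos i
    positivity
  have hκ0 : 0 ≤ κ := Finset.sum_nonneg fun i _ => hterm i
  set C := Real.sqrt (κ ^ 2 + Real.exp Λ ^ 2) with hC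
  set ρ := min (1 / (κ + 1)) (r / (C + 1)) with hρ
  have hC0 : 0 ≤ C := Real.sqrt_nonneg _
  have hρ0 : 0 < ρ := by positivity
  have hκρ : κ * ρ < 1 := by
    have h : ρ * (κ + 1) ≤ 1 := by
      rw [← le_div_iff₀ (by positivity)]; exact min_le_left _ _
    linarith
  have hCρ : C * ρ ≤ r := by
    have h : ρ * (C + 1) ≤ r := by
      rw [← le_div_iff₀ (by positivity)]; exact min_le_right _ _
    linarith
  obtain ⟨v₁, hv₁, hvol₁⟩ := exists_le_volume_baseDomain_inter lam hr
  obtain ⟨v₂, hv₂, hvol₂⟩ := exists_le_volume_baseDomain_inter lam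
    (by positivity : 0 < Real.exp (Λ * -|y₀|) * ρ)
  refine ⟨min v₁ ((∏ j, Real.exp (-(lam j * 1))) * v₂), lt_min hv₁ (by positivity), fun p hp hpy => ?_⟩
  obtain ⟨hp0, hpx, -⟩ := mem_approxHorosphere_iff.mp hp
  have hpx1 : p.2 ∈ baseDomain d := fun i =>
    (hpx i).trans (Real.exp_le_one_iff.mpr (by nlinarith [hpos i]))
  have hbm : MeasurableSet (baseDomain d) := by
    rw [baseDomain_eq_Icc]; exact measurableSet_Icc
  rcases hp0.eq_or_lt with h0 | h0
  · set A := baseDomain d ∩ scaled lam 0 ⁻¹' Metric.ball (scaled lam 0 p.2) r with hA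
    have hAm : MeasurableSet A := hbm.inter (measurable_scaled 0 measurableSet_ball)
    have hSm : MeasurableSet ({0} ×ˢ A : Set (Point d)) := (measurableSet_singleton 0).prod hAm
    have hpeq : p = (0, p.2) := Prod.ext h0 rfl
    have hsub : ({0} ×ˢ A : Set (Point d)) ⊆
        intrinsicBall lam (approxHorosphere lam) p r := by
      rintro ⟨y, x⟩ ⟨hy, hx⟩
      obtain rfl : y = 0 := hy
      refine ⟨mem_approxHorosphere_iff.mpr ⟨le_rfl, fun i => by simpa using hx.1 i, Or.inl rfl⟩, ?_⟩
      rw [hpeq]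
      exact (inducedDist_base_le hpx1 hx.1).trans_lt
        ((ENNReal.ofReal_lt_ofReal_iff hr).mpr (mem_scaled_preimage_ball.mp hx.2))
    calc _ ≤ ENNReal.ofReal v₁ :=
          ENNReal.ofReal_le_ofReal (min_le_left _ _)
      _ ≤ volume A := hvol₁ p.2 hpx1
      _ ≤ volume (baseDomain d ∩ baseParam d ⁻¹' ({0} ×ˢ A)) :=
          measure_mono fun x hx => ⟨hx.1, rfl, hx⟩
      _ ≤ _ := (le_horosphereVolume_base hSm).trans (measure_mono hsub)
  · set A := baseDomain d ∩ scaled lam 0 ⁻¹' Metric.ball (scaled lam 0 p.2)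
      (Real.exp (Λ * -|y₀|) * ρ) with hA
    have hAm : MeasurableSet A := hbm.inter (measurable_scaled 0 measurableSet_ball)
    have hN : ∀ x ∈ A, ‖scaled lam p.1 (x - p.2)‖ < ρ := fun x hx => by
      have h := mem_scaled_preimage_ball.mp hx.2
      have h' := norm_scaled_le hpos hΛ (abs_nonneg y₀)
        (by linarith [neg_abs_le y₀] : 0 ≤ p.1 + |y₀|) (x - p.2)
      refine h'.trans_lt ?_
      calc _ < Real.exp (Λ * |y₀|) * (Real.exp (Λ * -|y₀|) * ρ) := by gcongr
        _ = ρ := by rw [← mul_assoc, ← Real.exp_add]; simp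
    have hκ : ∀ i, 2 / lam i * Real.exp (lam i / 2) * Real.exp (lam i * p.1 / 2) ≤ κ := fun i =>
      (mul_le_of_le_one_right (hterm i)
        (Real.exp_le_one_iff.mpr (by nlinarith [hpos i]))).trans
        (Finset.single_le_sum (fun j _ => hterm j) (Finset.mem_univ i))
    have hA1 : ∀ x ∈ A, ∀ i, |x i| ≤ 1 := fun x hx => hx.1
    have hprod : ∏ j, Real.exp (-(lam j * 1)) ≤ ∏ j, Real.exp (-(lam j * (p.1 + κ * ρ))) :=
      prod_exp_antitone hpos (by linarith)
    calc ENNReal.ofReal (min v₁ ((∏ j, Real.exp (-(lam j * 1))) * v₂))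
        ≤ ENNReal.ofReal ((∏ j, Real.exp (-(lam j * 1))) * v₂) :=
          ENNReal.ofReal_le_ofReal (min_le_right _ _)
      _ = ENNReal.ofReal (∏ j, Real.exp (-(lam j * 1))) * ENNReal.ofReal v₂ :=
          ENNReal.ofReal_mul (by positivity)
      _ ≤ ENNReal.ofReal (∏ j, Real.exp (-(lam j * (p.1 + κ * ρ)))) * volume A := by
          gcongr
          exact hvol₂ p.2 hpx1
      _ ≤ _ := le_horosphereVolume_ball hpos hΛ (mem_lowerSheet_of_neg hp h0) hκ hκρ hr
          (le_trans (by rw [hC]; gcongr; nlinarith) hCρ) hAm hN (Or.inr hA1)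

theorem exists_volume_ball_le (hpos : ∀ i, 0 < lam i) {r : ℝ} (hr : 0 < r) (y₀ : ℝ) :
    ∃ W : ℝ, ∀ p ∈ approxHorosphere lam, y₀ ≤ p.1 →
      horosphereVolume lam (intrinsicBall lam (approxHorosphere lam) p r) ≤ ENNReal.ofReal W := by
  set S : Set (Point d) := Prod.fst ⁻¹' Ici (y₀ - r) with hS
  have hSm : MeasurableSet S := measurable_fst measurableSet_Ici
  set M := Real.sqrt (1 + ∑ i, 4 / lam i ^ 2) * ∏ j, Real.exp (-(lam j * (y₀ - r))) with hMdef
  have hM : ∀ q ∈ S ∩ lowerSheet lam, ∀ i, graphDensity lam i q.1 ≤ M := by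
    intro q hq i
    refine mul_le_mul (Real.sqrt_le_sqrt ?_) (prod_exp_antitone hpos hq.1) (by positivity)
      (by positivity)
    have h1 : 4 / lam i ^ 2 ≤ ∑ i, 4 / lam i ^ 2 :=
      Finset.single_le_sum (f := fun i => 4 / lam i ^ 2) (fun j _ => by positivity)
        (Finset.mem_univ i)
    have h2 : 4 / lam i ^ 2 * Real.exp (lam i * q.1) ≤ 4 / lam i ^ 2 :=
      mul_le_of_le_one_right (by positivity)
        (Real.exp_le_one_iff.mpr (by nlinarith [hpos i, hq.2.1]))
    linarith
  have hle := horosphereVolume_le hpos hSm hM (A := baseDomain d)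
    fun q hq => abs_le_one_of_mem_lowerSheet hpos hq.2
  have htop : volume (baseDomain d ∩ baseParam d ⁻¹' S) +
      ENNReal.ofReal M * volume (baseDomain d) ≠ ⊤ :=
    ENNReal.add_ne_top.mpr ⟨((measure_mono inter_subset_left).trans_lt
      (volume_baseDomain_lt_top d)).ne,
      ENNReal.mul_ne_top ENNReal.ofReal_ne_top (volume_baseDomain_lt_top d).ne⟩
  rw [← ENNReal.ofReal_toReal htop] at hle
  refine ⟨(volume (baseDomain d ∩ baseParam d ⁻¹' S) +
    ENNReal.ofReal M * volume (baseDomain d)).toReal, fun p _ hpy => ?_⟩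
  refine (measure_mono fun q hq => ?_).trans hle
  have := neg_le_of_abs_le (abs_fst_sub_le_of_mem_ball hr hq)
  exact (by linarith : y₀ - r ≤ q.1)

theorem exists_volume_ball_bounds [NeZero d] (hpos : ∀ i, 0 < lam i) {r : ℝ} (hr : 0 < r) :
    ∃ v W : ℝ, 0 < v ∧ v < W ∧ ∀ p ∈ approxHorosphere lam,
      ENNReal.ofReal v ≤ horosphereVolume lam (intrinsicBall lam (approxHorosphere lam) p r) ∧
      horosphereVolume lam (intrinsicBall lam (approxHorosphere lam) p r) ≤ ENNReal.ofReal W := by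
  obtain ⟨y₀, -, hfar⟩ := volume_ball_asymptotics hpos one_half_pos hr
  obtain ⟨v, hv, hnear⟩ := exists_le_volume_ball hpos hr y₀
  obtain ⟨W, hW⟩ := exists_volume_ball_le hpos hr y₀
  have hI : 0 < (1 - 1 / 2) * (unitBallVolume d * r ^ d) := by
    have := unitBallVolume_pos d
    positivity
  refine ⟨min v ((1 - 1 / 2) * (unitBallVolume d * r ^ d)),
    max (v + 1) (max W ((1 + 1 / 2) * (unitBallVolume d * r ^ d))), lt_min hv hI,
    (min_le_left _ _).trans_lt (lt_max_of_lt_left (by linarith)), fun p hp => ?_⟩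
  rcases le_total p.1 y₀ with h | h
  · exact ⟨(ENNReal.ofReal_le_ofReal (min_le_right _ _)).trans (hfar p hp h).1,
      (hfar p hp h).2.trans (ENNReal.ofReal_le_ofReal
        ((le_max_right _ _).trans (le_max_right _ _)))⟩
  · exact ⟨(ENNReal.ofReal_le_ofReal (min_le_left _ _)).trans (hnear p hp h),
      (hW p hp h).trans (ENNReal.ofReal_le_ofReal ((le_max_left _ _).trans (le_max_right _ _)))⟩

end Heintze

theorem mainTheorem7 (d : ℕ) (hd : 1 ≤ d) (lam : Fin d → ℝ) (hpos : ∀ i, 0 < lam i)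
    (hmono : Monotone lam) :
    (∀ ε : ℝ, 0 < ε → ∀ r : ℝ, 0 < r → ∃ y₀ : ℝ, y₀ < 0 ∧
      ∀ p ∈ Heintze.approxHorosphere lam, p.1 ≤ y₀ →
        Heintze.horosphereVolume lam
            (Heintze.intrinsicBall lam (Heintze.approxHorosphere lam) p r) ≠ ⊤ ∧
        |(Heintze.horosphereVolume lam
              (Heintze.intrinsicBall lam (Heintze.approxHorosphere lam) p r)).toReal /
            (Heintze.unitBallVolume d * r ^ d) - 1| ≤ ε) ∧
    Heintze.HasControlledVolume
      (fun p q : Heintze.approxHorosphere lam =>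
        Heintze.inducedDist lam (Heintze.approxHorosphere lam) (p : Heintze.Point d) q)
      (Measure.comap (Subtype.val : Heintze.approxHorosphere lam → Heintze.Point d)
        (Heintze.horosphereVolume lam)) := by
  have : NeZero d := ⟨by omega⟩
  refine ⟨fun ε hε r hr => ?_, fun r hr => ?_⟩
  · obtain ⟨y₀, hy₀, h⟩ := Heintze.volume_ball_asymptotics hpos hε hr
    refine ⟨y₀, hy₀, fun p hp hpy => ?_⟩
    obtain ⟨hlow, hup⟩ := h p hp hpy
    have hI : 0 < Heintze.unitBallVolume d * r ^ d :=
      mul_pos (Heintze.unitBallVolume_pos d) (by positivity)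
    have htop := ne_top_of_le_ne_top ENNReal.ofReal_ne_top hup
    refine ⟨htop, ?_⟩
    rw [ENNReal.ofReal_le_iff_le_toReal htop, ← le_div_iff₀ hI] at hlow
    have hup' := ENNReal.toReal_le_of_le_ofReal (by positivity) hup
    rw [← div_le_iff₀ hI] at hup'
    exact abs_le.mpr ⟨by linarith, by linarith⟩
  · obtain ⟨v, W, hv, hvW, h⟩ := Heintze.exists_volume_ball_bounds hpos hr
    refine ⟨v, W, hv, hvW, fun p => ?_⟩
    have hball : Subtype.val '' {q : Heintze.approxHorosphere lam |
        Heintze.inducedDist lam (Heintze.approxHorosphere lam) (p : Heintze.Point d) q <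
          ENNReal.ofReal r} =
        Heintze.intrinsicBall lam (Heintze.approxHorosphere lam) p r := by
      ext q
      exact ⟨fun ⟨q, hq, h⟩ => h ▸ ⟨q.2, hq⟩, fun hq => ⟨⟨q, hq.1⟩, hq.2, rfl⟩⟩
    have hm : MeasurableSet (Heintze.approxHorosphere lam) := isClosed_frontier.measurableSet
    rw [(MeasurableEmbedding.subtype_coe hm).comap_apply, hball]
    exact h p p.2
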